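/- Let $K$ be a field, $S=K[x_1,\dots,x_n]$, and order the monomials of $S$ lexicographically with $x_1>x_2>\cdots>x_n$. Let $d\ge 2$, and let $u=x_1^{a_1}\cdots x_n^{a_n}$ and $v=x_1^{b_1}\cdots x_n^{b_n}$ be monomials of degree $d$ with $x_1\mid u$ and $x_1\nmid v$. Let $I=(L(u,v))$ be the lexsegment ideal generated by the set $L(u,v)$ of all monomials $w$ of degree $d$ with $u\ge_{\mathrm{lex}} w\ge_{\mathrm{lex}} v$. Write $\operatorname{supp}(v)=\{i : x_i\mid v\}$, and for $2\le j\le t-2$ with $t\le n$ put $P_{j,t}=(x_2,\dots,x_j,x_t,\dots,x_n)$. The depth of $S/I$ is the maximal length of an $S/I$-regular sequence contained in $(x_1,\dots,x_n)$. Suppose that $\operatorname{depth}(S/I)>0$. Then $a_1=1$, so that $u=x_1x_l^{a_l}\cdots x_n^{a_n}$ for some $l\ge 2$ with $a_l>0$, and the following hold. (i) Let $\operatorname{depth}(S/I)=1$. (a) If $a_l<d-1$, then $$\operatorname{Ass}(S/I)=\{(x_2,\dots,x_n)\}\cup\{(x_1,\dots,x_j): j\in\operatorname{supp}(v)\setminus\{n\}\}\cup\{P_{j,l}: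 j\in\operatorname{supp}(v),\ j\le l-2\}\cup\{P_{j,l+1}: j\in\operatorname{supp}(v),\ j\le l-1\}.$$ (b) If $a_l=d-1$, then $$\operatorname{Ass}(S/I)=\{(x_2,\dots,x_n)\}\cup\{(x_1,\dots,x_j): j\in\operatorname{supp}(v)\setminus\{n\}\}\cup\{P_{j,l}: j\in\operatorname{supp}(v),\ j\le l-2\}.$$ (ii) Let $\operatorname{depth}(S/I)>1$. Then $j\le l-2$ for every $j\in\operatorname{supp}(v)$ (so that $P_{j,l}$ and $P_{j,l+1}$ are defined). (a) If $a_l<d-1$, then $$\operatorname{Ass}(S/I)=\{(x_1,\dots,x_j): j\in\operatorname{supp}(v)\setminus\{n\}\}\cup\{P_{j,l}: j\in\operatorname{supp}(v)\}\cup\{P_{j,l+1}: j\in\operatorname{supp}(v)\}.$$ (b) If $a_l=d-1$, then $$\operatorname{Ass}(S/I)=\{(x_1,\dots,x_j): j\in\operatorname{supp}(v)\setminus\{n\}\}\cup\{P_{j,l}: j\in\operatorname{supp}(v)\}.$$ -/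

import Mathlib

/-!
Throughout, `S = MvPolynomial (Fin n) K`, and the index `i : Fin n` (with `i = 0, …, n - 1`) stands
for the variable `x_{i+1}`.  Monomials are identified with their exponent vectors `Fin n →₀ ℕ`.
-/

namespace LexSegment

open MvPolynomial

/-- The lexsegment set `L(u, v)` in degree `d`: the monomials `w` of degree `d` with
`u ≥_lex w ≥_lex v`.  The order on `Lex (Fin n →₀ ℕ)` compares the exponents of `x₁` first,
so it is the lexicographic order with `x₁ > x₂ > ⋯ > xₙ`. -/
def lexsegment {n : ℕ} (d : ℕ) (u v : Fin n →₀ ℕ) : Set (Fin n →₀ ℕ) :=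
  {w | w.degree = d ∧ toLex w ≤ toLex u ∧ toLex v ≤ toLex w}

/-- The lexsegment ideal `(L(u, v))`, generated by the monomials in the lexsegment set. -/
noncomputable def lexsegmentIdeal (K : Type*) [Field K] {n : ℕ} (d : ℕ) (u v : Fin n →₀ ℕ) :
    Ideal (MvPolynomial (Fin n) K) :=
  Ideal.span ((fun w => monomial w (1 : K)) '' lexsegment d u v)

/-- The graded maximal ideal `𝔪 = (x₁, …, xₙ)`. -/
noncomputable def maxIdeal (K : Type*) [Field K] (n : ℕ) : Ideal (MvPolynomial (Fin n) K) :=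
  Ideal.span (Set.range X)

/-- The depth of an `S`-module `M`: the supremum of the lengths of `M`-regular sequences
contained in `𝔪 = (x₁, …, xₙ)`. -/
noncomputable def depth (K : Type*) [Field K] (n : ℕ) (M : Type*) [AddCommGroup M]
    [Module (MvPolynomial (Fin n) K) M] : ℕ∞ :=
  sSup {k : ℕ∞ | ∃ rs : List (MvPolynomial (Fin n) K),
    (∀ r ∈ rs, r ∈ maxIdeal K n) ∧ RingTheory.Sequence.IsRegular M rs ∧ k = (rs.length : ℕ∞)}

/-- The ideal generated by the first variables up to and including the one with index `j`. -/
noncomputable def initialPrime (K : Type*) [Field K] {n : ℕ} (j : Fin n) : Ideal (MvPolynomial (Fin n) K) :=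
  Ideal.span (X '' {i : Fin n | i ≤ j})

/-- The ideal generated by all variables except `x₁`, that is `(x₂, …, xₙ)`. -/
noncomputable def tailPrime (K : Type*) [Field K] (n : ℕ) : Ideal (MvPolynomial (Fin n) K) :=
  Ideal.span (X '' {i : Fin n | 1 ≤ (i : ℕ)})

/-- The ideal `P_{j,t}`, generated by the variables from `x₂` up to and including the one with
index `j`, together with those from index `t` on. All indices are counted from `0`, so in terms
of one-based indices this is `P_{j+1,t+1} = (x₂, …, x_{j+1}, x_{t+1}, …, xₙ)`. -/
noncomputable def mixedPrime (K : Type*) [Field K] (n : ℕ) (j t : ℕ) : Ideal (MvPolynomial (Fin n) K) :=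
  Ideal.span (X '' {i : Fin n | (1 ≤ (i : ℕ) ∧ (i : ℕ) ≤ j) ∨ t ≤ (i : ℕ)})

end LexSegment

/-!
The associated primes of `S / I`, for `I` generated by a lexsegment `L(u, v)`.

In comments, numerals in subscripts count variables from one, as in `x₁, …, xₙ`, while a letter as
in `x_j` stands for the variable with index `j : Fin n`.

If `P` is associated to a monomial ideal `I`, then `P` is generated by variables and
`P = (I : x^m)` for a monomial `x^m` (`mem_associatedPrimes_span_monomial_iff`). Everything is
thereby reduced to the question for which sets `F` of variables some `x^m ∉ I` is pushed into `I`
by the variables in `F`, but by no monomial in the other variables (`IsColon`).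

Positive depth means that `𝔪` is not associated, which forces `x₁² ∤ u`. So `I = A + x₁ B`, where
`A` is generated by the monomials of degree `d` in `x₂, …, xₙ` that are at least `v`, and `x₁ B` by
the multiples of `x₁` that are at most `u` (`tailSegment`, `headSegment`). The generators of `A`
are stable under replacing a variable by a larger one other than `x₁`; those of `x₁ B` avoid all
variables strictly between `x₁` and `x_l`, and `x_k^{d-1} ∈ B` for `k > l`. Hence:

* if `x₁ ∈ P`, then `P = (x₁, …, x_j)`;
* if `x₁ ∉ P`, then the variables missing in `P`, other than `x₁`, form an interval from `x_{j+1}`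
  to `x_{l-1}`, or to `x_l` if `u ≠ x₁ x_l^{d-1}`, or there are none.

Unless `P = (x₂, …, xₙ)`, it follows that `x_j` pushes `x^m` into `A` while powers of `x_{j+1}` do
not, which is possible only if `x_j ∣ v` (`ne_zero_of_add_single_mem_tail`). Explicit witnesses show that all these
primes, apart from `𝔪` and `(x₂, …, xₙ)`, do occur.

The prime `(x₂, …, xₙ)` decides whether the depth is one. If it is associated, Nakayama's lemma
excludes a regular sequence of length two in `𝔪` (`tailPrime_notMem_associatedPrimes`). If it is
not, then `v = x₂^{d-1} x_i` with `i ≤ l - 2` (`NormalForm.exists_v_eq`), and `x_{l-1}, x₁ - xₙ` is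
a regular sequence (`NormalForm.two_le_depth`).
-/

namespace LexSegment

open MvPolynomial

/-! ### Monomial ideals and their associated primes -/

section MonomialIdeal

variable {σ K : Type*} [Field K]

theorem mem_span_monomial_iff {s : Set (σ →₀ ℕ)} {f : MvPolynomial σ K} :
    f ∈ Ideal.span ((fun w => monomial w (1 : K)) '' s) ↔ ∀ x ∈ f.support, x ∈ upperClosure s := by
  simp only [mem_ideal_span_monomial_image, mem_upperClosure]

theorem monomial_mem_span_monomial_iff {s : Set (σ →₀ ℕ)} {m : σ →₀ ℕ} :
    monomial m (1 : K) ∈ Ideal.span ((fun w => monomial w (1 : K)) '' s) ↔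
      m ∈ upperClosure s := by
  classical
  simp [mem_span_monomial_iff, support_monomial]

theorem monomial_mul_mem_span_monomial_iff {s : Set (σ →₀ ℕ)} {m : σ →₀ ℕ}
    {f : MvPolynomial σ K} :
    monomial m 1 * f ∈ Ideal.span ((fun w => monomial w (1 : K)) '' s) ↔
      ∀ x ∈ f.support, m + x ∈ upperClosure s := by
  rw [mem_span_monomial_iff]
  constructor
  · intro h x hx
    apply h
    rw [mem_support_iff, coeff_monomial_mul, one_mul]
    exact mem_support_iff.mp hx
  · intro h x hx
    classical
    rw [mem_support_iff, coeff_monomial_mul'] at hx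
    split_ifs at hx with hmx
    · obtain ⟨y, rfl⟩ := exists_add_of_le hmx
      exact h y (by simpa using hx)
    · exact absurd rfl hx

/-- An ideal generated by variables is prime: it is the kernel of the substitution that sets these
variables to zero. -/
theorem isPrime_span_X_image (F : Set σ) :
    (Ideal.span (X '' F : Set (MvPolynomial σ K))).IsPrime := by
  classical
  let φ : MvPolynomial σ K →ₐ[K] MvPolynomial σ K := aeval fun i => if i ∈ F then 0 else X i
  have hsub : ∀ f, f - φ f ∈ Ideal.span (X '' F : Set (MvPolynomial σ K)) := by
    intro f
    induction f using MvPolynomial.induction_on with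
    | C a => simp [φ, algebraMap_eq]
    | add p q hp hq => simpa [add_sub_add_comm] using Ideal.add_mem _ hp hq
    | mul_X p i hp =>
      have hi : X i - φ (X i) ∈ Ideal.span (X '' F : Set (MvPolynomial σ K)) := by
        by_cases h : i ∈ F
        · simpa [φ, h] using Ideal.subset_span (Set.mem_image_of_mem X h)
        · simp [φ, h]
      have : p * X i - φ (p * X i) = X i * (p - φ p) + φ p * (X i - φ (X i)) := by
        rw [map_mul]; ring
      rw [this]
      exact Ideal.add_mem _ (Ideal.mul_mem_left _ _ hp) (Ideal.mul_mem_left _ _ hi)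
  have hker : Ideal.span (X '' F : Set (MvPolynomial σ K)) = RingHom.ker φ := by
    apply le_antisymm
    · rw [Ideal.span_le]
      rintro _ ⟨i, hi, rfl⟩
      simp [φ, hi]
    · intro f hf
      have := hsub f
      rwa [(RingHom.mem_ker).mp hf, sub_zero] at this
  rw [hker]
  exact RingHom.ker_isPrime φ

theorem mem_colon_mk_iff {R : Type*} [CommRing R] {I : Ideal R} {a b : R} :
    a ∈ (⊥ : Submodule R (R ⧸ I)).colon {Ideal.Quotient.mk I b} ↔ a * b ∈ I := by
  rw [Submodule.mem_colon_singleton, Submodule.mem_bot, ← Ideal.Quotient.eq_zero_iff_mem,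
    map_mul]
  rfl

theorem exists_X_mem_of_monomial_mem {P : Ideal (MvPolynomial σ K)} (hP : P.IsPrime)
    {x : σ →₀ ℕ} (hx : monomial x (1 : K) ∈ P) : ∃ i, x i ≠ 0 ∧ X i ∈ P := by
  rw [monomial_eq, map_one, one_mul, Finsupp.prod] at hx
  obtain ⟨i, hi, h⟩ := (hP.prod_mem_iff).mp hx
  exact ⟨i, Finsupp.mem_support_iff.mp hi, hP.mem_of_pow_mem _ h⟩

/-- An associated prime of a monomial ideal is a monomial ideal. Among all `f` with `P = (I : f)`,
one with the fewest terms is chosen. If `g ∈ P` has leading monomial `x^a`, then `x^a` times the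
leading monomial of `f` lies in `I`, so `x^a f` is congruent modulo `I` to a polynomial with
fewer terms. As `(I : x^a f) = P` unless `x^a ∈ P`, the latter holds by minimality. -/
theorem monomial_mem_of_mem_associatedPrime [LinearOrder σ] [WellFoundedGT σ] [Finite σ]
    {s : Set (σ →₀ ℕ)} {P : Ideal (MvPolynomial σ K)}
    (hP : P ∈ associatedPrimes (MvPolynomial σ K)
      (MvPolynomial σ K ⧸ Ideal.span ((fun w => monomial w (1 : K)) '' s)))
    {g : MvPolynomial σ K} (hg : g ∈ P) {x : σ →₀ ℕ} (hx : x ∈ g.support) :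
    monomial x (1 : K) ∈ P := by
  classical
  set I := Ideal.span ((fun w => monomial w (1 : K)) '' s) with hI
  obtain ⟨hprime, y, hy⟩ := isAssociatedPrime_iff.mp (AssociatedPrimes.mem_iff.mp hP)
  obtain ⟨f₀, rfl⟩ := Ideal.Quotient.mk_surjective y
  have hex : ∃ N, ∃ f : MvPolynomial σ K, f.support.card = N ∧ ∀ a, a ∈ P ↔ a * f ∈ I :=
    ⟨_, f₀, rfl, fun a => by rw [hy, mem_colon_mk_iff]⟩
  obtain ⟨f, hfN, hf⟩ := Nat.find_spec hex
  have hmin : ∀ f' : MvPolynomial σ K, (∀ a, a ∈ P ↔ a * f' ∈ I) →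
      f.support.card ≤ f'.support.card := fun f' h' => by
    rw [hfN]; exact Nat.find_min' hex ⟨f', rfl, h'⟩
  have hf0 : f ≠ 0 := by
    rintro rfl
    exact hprime.ne_top ((Ideal.eq_top_iff_one P).mpr ((hf 1).mpr (by simp)))
  let o : MonomialOrder σ := MonomialOrder.lex
  have herase : ∀ h : MvPolynomial σ K, (h - monomial (o.degree h) (o.leadingCoeff h)).support ⊆
      h.support.erase (o.degree h) := by
    intro h z hz
    rw [mem_support_iff, coeff_sub, coeff_monomial] at hz
    rw [Finset.mem_erase, mem_support_iff]
    split_ifs at hz with hze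
    · subst hze
      exact absurd (sub_self _) hz
    · exact ⟨Ne.symm hze, by simpa using hz⟩
  have hlead : ∀ g ∈ P, g ≠ 0 → monomial (o.degree g) (1 : K) ∈ P := by
    intro g hg hg0
    have hmem : o.degree g + o.degree f ∈ upperClosure s := by
      refine mem_span_monomial_iff.mp ((hf g).mp hg) _ ?_
      rw [mem_support_iff, o.coeff_mul_of_degree_add]
      exact mul_ne_zero (o.leadingCoeff_ne_zero_iff.mpr hg0) (o.leadingCoeff_ne_zero_iff.mpr hf0)
    by_contra hnot
    let f₁ := f - monomial (o.degree f) (o.leadingCoeff f)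
    let f' := monomial (o.degree g) (1 : K) * f₁
    have hdiff : monomial (o.degree g) (1 : K) * f - f' ∈ I := by
      have : monomial (o.degree g) (1 : K) * f - f' =
          C (o.leadingCoeff f) * monomial (o.degree g + o.degree f) (1 : K) := by
        simp only [f', f₁, mul_sub, sub_sub_cancel, monomial_mul, one_mul, C_mul_monomial, mul_one]
      rw [this]
      exact Ideal.mul_mem_left _ _ (monomial_mem_span_monomial_iff.mpr hmem)
    have hf' : ∀ a, a ∈ P ↔ a * f' ∈ I := by
      intro a
      have h1 : a * f' ∈ I ↔ a * (monomial (o.degree g) (1 : K) * f) ∈ I := by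
        have h2 := Ideal.mul_mem_left I a hdiff
        rw [mul_sub] at h2
        exact ⟨fun h => by simpa using I.add_mem h2 h, fun h => by simpa using I.sub_mem h h2⟩
      rw [h1, ← mul_assoc, ← hf]
      exact ⟨fun h => Ideal.mul_mem_right _ _ h,
        fun h => (hprime.mem_or_mem h).resolve_right hnot⟩
    have hcard : f'.support.card < f.support.card := by
      have h1 : f'.support ⊆ f₁.support.image (o.degree g + ·) := by
        intro z hz
        rw [mem_support_iff, coeff_monomial_mul'] at hz
        split_ifs at hz with hle
        · obtain ⟨y, rfl⟩ := exists_add_of_le hle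
          exact Finset.mem_image.mpr ⟨y, by simpa using hz, rfl⟩
        · exact absurd rfl hz
      calc f'.support.card ≤ (f₁.support.image (o.degree g + ·)).card := Finset.card_le_card h1
        _ ≤ f₁.support.card := Finset.card_image_le
        _ ≤ (f.support.erase (o.degree f)).card := Finset.card_le_card (herase f)
        _ < f.support.card := Finset.card_erase_lt_of_mem (o.degree_mem_support hf0)
    exact absurd (hmin f' hf') (not_le.mpr hcard)
  induction hN : g.support.card using Nat.strong_induction_on generalizing g with
  | _ N ih =>
    have hg0 : g ≠ 0 := by rintro rfl; simp at hx
    by_cases hxe : x = o.degree g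
    · exact hxe ▸ hlead g hg hg0
    · have hmem : g - monomial (o.degree g) (o.leadingCoeff g) ∈ P := by
        refine Ideal.sub_mem _ hg ?_
        have := Ideal.mul_mem_left P (C (o.leadingCoeff g)) (hlead g hg hg0)
        rwa [C_mul_monomial, mul_one] at this
      refine ih _ ?_ hmem ?_ rfl
      · rw [← hN]
        exact lt_of_le_of_lt (Finset.card_le_card (herase g))
          (Finset.card_erase_lt_of_mem (o.degree_mem_support hg0))
      · rw [mem_support_iff, coeff_sub, coeff_monomial, if_neg (Ne.symm hxe), sub_zero]
        exact mem_support_iff.mp hx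

/-- For the monomial ideal `I` with generators `x^w`, `w ∈ s`, this says that `(I : x^m)` is
generated by the variables with index in `F`. -/
def IsColon (s : Set (σ →₀ ℕ)) (m : σ →₀ ℕ) (F : Set σ) : Prop :=
  (∀ i ∈ F, m + Finsupp.single i 1 ∈ upperClosure s) ∧
    ∀ y : σ →₀ ℕ, (∀ i ∈ F, y i = 0) → m + y ∉ upperClosure s

theorem IsColon.notMem {s : Set (σ →₀ ℕ)} {m : σ →₀ ℕ} {F : Set σ} (hF : IsColon s m F) :
    m ∉ upperClosure s := by
  simpa using hF.2 0 fun _ _ => rfl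

theorem IsColon.add_single_notMem {s : Set (σ →₀ ℕ)} {m : σ →₀ ℕ} {F : Set σ}
    (hF : IsColon s m F) {i : σ} (hi : i ∉ F) (a : ℕ) :
    m + Finsupp.single i a ∉ upperClosure s :=
  hF.2 _ fun k hk => Finsupp.single_eq_of_ne (by rintro rfl; exact hi hk)

/-- The associated primes of a monomial ideal `I` are the ideals generated by sets `F` of variables
that have the form `(I : x^m)` for a monomial `x^m`. -/
theorem mem_associatedPrimes_span_monomial_iff [LinearOrder σ] [WellFoundedGT σ] [Finite σ]
    {s : Set (σ →₀ ℕ)} {P : Ideal (MvPolynomial σ K)} :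
    P ∈ associatedPrimes (MvPolynomial σ K)
      (MvPolynomial σ K ⧸ Ideal.span ((fun w => monomial w (1 : K)) '' s)) ↔
    ∃ (F : Set σ) (m : σ →₀ ℕ), P = Ideal.span (X '' F) ∧ IsColon s m F := by
  classical
  constructor
  · intro hP
    have hmono := fun {g} hg {x} hx =>
      monomial_mem_of_mem_associatedPrime hP (g := g) hg (x := x) hx
    obtain ⟨hprime, y, hy⟩ := isAssociatedPrime_iff.mp (AssociatedPrimes.mem_iff.mp hP)
    obtain ⟨f, rfl⟩ := Ideal.Quotient.mk_surjective y
    have hf : ∀ a, a ∈ P ↔ a * f ∈ Ideal.span ((fun w => monomial w (1 : K)) '' s) :=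
      fun a => by rw [hy, mem_colon_mk_iff]
    let F : Set σ := {i | (X i : MvPolynomial σ K) ∈ P}
    have hPF : P = Ideal.span (X '' F) := by
      apply le_antisymm
      · intro g hg
        rw [mem_ideal_span_X_image]
        intro x hx
        obtain ⟨i, hi, hiP⟩ := exists_X_mem_of_monomial_mem hprime (hmono hg hx)
        exact ⟨i, hiP, hi⟩
      · rw [Ideal.span_le]
        rintro _ ⟨i, hi, rfl⟩
        exact hi
    obtain ⟨m, hmf, hm⟩ : ∃ m ∈ f.support, ∀ y : σ →₀ ℕ, (∀ i ∈ F, y i = 0) →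
        m + y ∉ upperClosure s := by
      -- Otherwise the product of suitable monomials outside `P` multiplies `f` into the ideal.
      by_contra! hcon
      choose! y hyF hyU using hcon
      have hnot : monomial (∑ m ∈ f.support, y m) (1 : K) ∉ P := by
        intro hmem
        obtain ⟨i, hi, hiP⟩ := exists_X_mem_of_monomial_mem hprime hmem
        rw [Finsupp.finsetSum_apply] at hi
        obtain ⟨m, hm, hmi⟩ := Finset.exists_ne_zero_of_sum_ne_zero hi
        exact hmi (hyF m hm i hiP)
      refine hnot ((hf _).mpr (monomial_mul_mem_span_monomial_iff.mpr fun x hx => ?_))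
      refine (upperClosure s).upper ?_ (hyU x hx)
      rw [add_comm]
      exact add_le_add_left (Finset.single_le_sum (fun _ _ => zero_le) hx) _
    refine ⟨F, m, hPF, fun i hi => ?_, hm⟩
    have := (hf _).mp hi
    rw [← pow_one (X i), X_pow_eq_monomial, monomial_mul_mem_span_monomial_iff] at this
    rw [add_comm]
    exact this m hmf
  · rintro ⟨F, m, rfl, hmF, hm⟩
    rw [AssociatedPrimes.mem_iff, isAssociatedPrime_iff]
    refine ⟨isPrime_span_X_image F, Ideal.Quotient.mk _ (monomial m 1), ?_⟩
    ext g
    rw [mem_colon_mk_iff, mul_comm, monomial_mul_mem_span_monomial_iff, mem_ideal_span_X_image]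
    refine forall₂_congr fun x _ => ⟨?_, fun h => ?_⟩
    · rintro ⟨i, hi, hxi⟩
      refine (upperClosure s).upper (add_le_add_right ?_ m) (hmF i hi)
      rw [Finsupp.single_le_iff]
      exact Nat.one_le_iff_ne_zero.mpr hxi
    · by_contra! hcon
      exact hm x hcon h

/-- A zero divisor modulo a monomial ideal lies in an associated prime `(I : x^m)`. -/
theorem exists_isColon_of_mul_mem [LinearOrder σ] [WellFoundedGT σ] [Finite σ]
    {s : Set (σ →₀ ℕ)} {f g : MvPolynomial σ K}
    (hfg : g * f ∈ Ideal.span ((fun w => monomial w (1 : K)) '' s))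
    (hf : f ∉ Ideal.span ((fun w => monomial w (1 : K)) '' s)) :
    ∃ (F : Set σ) (m : σ →₀ ℕ), IsColon s m F ∧ g ∈ Ideal.span (X '' F) := by
  obtain ⟨P, hP, hle⟩ := exists_le_isAssociatedPrime_of_isNoetherianRing (MvPolynomial σ K)
    (Ideal.Quotient.mk (Ideal.span ((fun w => monomial w (1 : K)) '' s)) f)
    (fun h => hf (Ideal.Quotient.eq_zero_iff_mem.mp h))
  obtain ⟨F, m, rfl, hF⟩ := mem_associatedPrimes_span_monomial_iff.mp hP
  exact ⟨F, m, hF, hle (mem_colon_mk_iff.mpr hfg)⟩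

end MonomialIdeal

/-! ### Depth and associated primes -/

section Depth

open scoped Pointwise

variable {K : Type*} [Field K] {n : ℕ}

theorem one_notMem_maxIdeal : (1 : MvPolynomial (Fin n) K) ∉ maxIdeal K n := by
  classical
  rw [maxIdeal, ← Set.image_univ, mem_ideal_span_X_image]
  intro h
  obtain ⟨i, -, hi⟩ := h 0 (by simp)
  exact hi rfl

theorem tailPrime_le_maxIdeal : tailPrime K n ≤ maxIdeal K n :=
  Ideal.span_mono (Set.image_subset_range _ _)

theorem exists_eq_X_zero_mul_add [NeZero n] {f : MvPolynomial (Fin n) K} (hf : f ∈ maxIdeal K n) :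
    ∃ q, ∃ p ∈ tailPrime K n, f = X 0 * q + p := by
  have hle : maxIdeal K n ≤ Ideal.span {X 0} ⊔ tailPrime K n := by
    rw [maxIdeal, Ideal.span_le]
    rintro _ ⟨i, rfl⟩
    by_cases hi : i = 0
    · exact Ideal.mem_sup_left (hi ▸ Ideal.mem_span_singleton_self _)
    · exact Ideal.mem_sup_right (Ideal.subset_span
        ⟨i, Nat.one_le_iff_ne_zero.mpr (fun h => hi (Fin.ext (by simpa using h))), rfl⟩)
  obtain ⟨a, ha, p, hp, h⟩ := Submodule.mem_sup.mp (hle hf)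
  obtain ⟨q, rfl⟩ := Ideal.mem_span_singleton'.mp ha
  exact ⟨q, p, hp, by rw [← h, mul_comm]⟩

variable {M : Type*} [AddCommGroup M] [Module (MvPolynomial (Fin n) K) M]

theorem notMem_of_isSMulRegular {f : MvPolynomial (Fin n) K} (hf : IsSMulRegular M f)
    {P : Ideal (MvPolynomial (Fin n) K)} (hP : P ∈ associatedPrimes (MvPolynomial (Fin n) K) M) :
    f ∉ P := by
  intro hmem
  have h1 : f ∈ ⋃ p ∈ associatedPrimes (MvPolynomial (Fin n) K) M, (p : Set _) :=
    Set.mem_biUnion hP hmem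
  rw [biUnion_associatedPrimes_eq_compl_regular] at h1
  exact h1 hf

theorem maxIdeal_notMem_associatedPrimes (h : 0 < depth K n M) :
    maxIdeal K n ∉ associatedPrimes (MvPolynomial (Fin n) K) M := by
  obtain ⟨k, ⟨rs, hmem, hreg, rfl⟩, hk⟩ := lt_sSup_iff.mp h
  obtain - | ⟨f, rs⟩ := rs
  · simp at hk
  · rw [RingTheory.Sequence.isRegular_cons_iff] at hreg
    exact fun hP => notMem_of_isSMulRegular hreg.1 hP (hmem f (by simp))

/-- If `(x₂, …, xₙ)` is associated to `M`, no regular sequence in `𝔪` has length two. Let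
`N = {y | (x₂, …, xₙ) y = 0}`, a nonzero module on which every element of `𝔪` acts as a multiple
of `x₁`: say `f` acts as `x₁ q` and `g` as `x₁ r`. As `f` is regular, `N / f N` embeds into
`M / f M`, so `g` is regular on `N / f N`. Now `g q y = f r y` for `y ∈ N` yields `q y ∈ x₁ q N`,
hence `N = x₁ N`, against Nakayama's lemma. -/
theorem tailPrime_notMem_associatedPrimes [NeZero n] [Module.Finite (MvPolynomial (Fin n) K) M]
    (h : 1 < depth K n M) :
    tailPrime K n ∉ associatedPrimes (MvPolynomial (Fin n) K) M := by
  obtain ⟨k, ⟨rs, hmem, hreg, rfl⟩, hk⟩ := lt_sSup_iff.mp h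
  obtain - | ⟨f, rs⟩ := rs
  · simp at hk
  obtain - | ⟨g, rs⟩ := rs
  · simp at hk
  rw [RingTheory.Sequence.isRegular_cons_iff, RingTheory.Sequence.isRegular_cons_iff] at hreg
  obtain ⟨hf, hg, -⟩ := hreg
  rw [isSMulRegular_iff_right_eq_zero_of_smul] at hf
  rw [isSMulRegular_quotient_iff_mem_of_smul_mem] at hg
  intro hP
  obtain ⟨-, e, he⟩ := isAssociatedPrime_iff.mp (AssociatedPrimes.mem_iff.mp hP)
  have hann : ∀ p, p ∈ tailPrime K n ↔ p • e = 0 := fun p => by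
    rw [he, Submodule.mem_colon_singleton, Submodule.mem_bot]
  obtain ⟨q, p₁, hp₁, rfl⟩ := exists_eq_X_zero_mul_add (hmem f (by simp))
  obtain ⟨r, p₂, hp₂, rfl⟩ := exists_eq_X_zero_mul_add (hmem g (by simp))
  let N : Submodule (MvPolynomial (Fin n) K) M :=
    { carrier := {y | ∀ p ∈ tailPrime K n, p • y = 0}
      add_mem' := fun ha hb p hp => by rw [smul_add, ha p hp, hb p hp, add_zero]
      zero_mem' := fun p _ => smul_zero p
      smul_mem' := fun c y hy p hp => by rw [smul_comm, hy p hp, smul_zero] }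
  have hNle : N ≤ Ideal.span {(X 0 : MvPolynomial (Fin n) K)} • N := by
    intro y hy
    have h1 : (X 0 * r + p₂) • (q • y) ∈
        (X 0 * q + p₁) • (⊤ : Submodule (MvPolynomial (Fin n) K) M) := by
      rw [Submodule.mem_smul_pointwise_iff_exists]
      refine ⟨r • y, trivial, ?_⟩
      rw [add_smul, add_smul, smul_comm p₁, smul_comm p₂, hy p₁ hp₁, hy p₂ hp₂, smul_zero,
        smul_zero, smul_smul, smul_smul]
      congr 2
      ring
    obtain ⟨z, -, hz⟩ := (Submodule.mem_smul_pointwise_iff_exists _ _ _).mp (hg _ h1)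
    have hzN : z ∈ N := fun p hp => hf _ (by
      rw [smul_comm, hz, smul_comm, hy p hp, smul_zero])
    have hyz : y - (X 0 : MvPolynomial (Fin n) K) • z = 0 := by
      have hmemN : y - (X 0 : MvPolynomial (Fin n) K) • z ∈ N :=
        N.sub_mem hy (N.smul_mem _ hzN)
      refine hf _ ?_
      rw [add_smul, hmemN p₁ hp₁, add_zero, mul_smul, smul_sub, ← hz, add_smul, hzN p₁ hp₁,
        add_zero, mul_comm, mul_smul, smul_comm q, sub_self, smul_zero]
    rw [sub_eq_zero.mp hyz]
    exact Submodule.smul_mem_smul (Ideal.mem_span_singleton_self _) hzN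
  obtain ⟨a, ha, haN⟩ := Submodule.exists_sub_one_mem_and_smul_eq_zero_of_fg_of_le_smul _ N
    (IsNoetherian.noetherian N) hNle
  have haP : a ∈ tailPrime K n := (hann a).mpr (haN e fun p hp => (hann p).mp hp)
  have ha' : a - 1 ∈ maxIdeal K n :=
    Ideal.span_mono (Set.singleton_subset_iff.mpr (Set.mem_range_self _)) ha
  exact one_notMem_maxIdeal (by simpa using Ideal.sub_mem _ (tailPrime_le_maxIdeal haP) ha')

/-- A regular sequence of length two on `S / I`, in terms of membership in ideals of `S`. -/
theorem two_le_depth_of_regular_pair {I : Ideal (MvPolynomial (Fin n) K)} (hI : I ≤ maxIdeal K n)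
    {f g : MvPolynomial (Fin n) K} (hfm : f ∈ maxIdeal K n) (hgm : g ∈ maxIdeal K n)
    (hf : ∀ a, f * a ∈ I → a ∈ I)
    (hg : ∀ a, g * a ∈ I ⊔ Ideal.span {f} → a ∈ I ⊔ Ideal.span {f}) :
    2 ≤ depth K n (MvPolynomial (Fin n) K ⧸ I) := by
  have hmem : ∀ r ∈ [f, g], r ∈ maxIdeal K n := by simp [hfm, hgm]
  refine le_sSup ⟨[f, g], hmem, ⟨?_, fun htop => ?_⟩, rfl⟩
  · refine .cons ?_ (.cons ?_ (.nil _ _))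
    · rw [isSMulRegular_quotient_iff_mem_of_smul_mem]
      exact hf
    · rw [isSMulRegular_quotient_iff_mem_of_smul_mem]
      intro x hx
      obtain ⟨a, rfl⟩ := Ideal.Quotient.mk_surjective x
      have key : ∀ b, Ideal.Quotient.mk I b ∈ f • (⊤ : Submodule (MvPolynomial (Fin n) K)
          (MvPolynomial (Fin n) K ⧸ I)) ↔ b ∈ I ⊔ Ideal.span {f} := by
        intro b
        rw [Submodule.mem_smul_pointwise_iff_exists]
        constructor
        · rintro ⟨y, -, hy⟩
          obtain ⟨c, rfl⟩ := Ideal.Quotient.mk_surjective y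
          change Ideal.Quotient.mk I (f * c) = _ at hy
          rw [eq_comm, Ideal.Quotient.eq] at hy
          exact Submodule.mem_sup.mpr ⟨_, hy, f * c,
            Ideal.mul_mem_right _ _ (Ideal.mem_span_singleton_self f), by ring⟩
        · intro hb
          obtain ⟨i, hi, j, hj, rfl⟩ := Submodule.mem_sup.mp hb
          obtain ⟨c, rfl⟩ := Ideal.mem_span_singleton'.mp hj
          refine ⟨Ideal.Quotient.mk I c, trivial, ?_⟩
          change Ideal.Quotient.mk I (f * c) = _
          rw [eq_comm, Ideal.Quotient.eq]
          convert hi using 1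
          ring
      exact (key a).mpr (hg a ((key (g * a)).mp hx))
  · have hle : Ideal.ofList [f, g] • (⊤ : Submodule (MvPolynomial (Fin n) K)
        (MvPolynomial (Fin n) K ⧸ I)) ≤ Submodule.map I.mkQ (maxIdeal K n) := by
      rw [Submodule.smul_le]
      intro r hr x _
      obtain ⟨a, rfl⟩ := Ideal.Quotient.mk_surjective x
      exact ⟨r * a, Ideal.mul_mem_right _ _ (Ideal.span_le.mpr hmem hr), rfl⟩
    obtain ⟨a, ha, h1⟩ := hle (htop ▸ Submodule.mem_top (x := Ideal.Quotient.mk I 1))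
    have h2 := hI ((Ideal.Quotient.eq).mp h1)
    exact one_notMem_maxIdeal (by simpa using Ideal.sub_mem _ ha h2)

end Depth

/-! ### The lexicographic order in a fixed degree -/

section Lex

variable {n : ℕ}

theorem exists_lex_lt {a b : Fin n →₀ ℕ} (h : toLex a < toLex b) :
    ∃ q, (∀ i < q, a i = b i) ∧ a q < b q :=
  Finsupp.Lex.lt_iff.mp h

theorem lex_lt_of {a b : Fin n →₀ ℕ} (q : Fin n) (h : ∀ i < q, a i = b i) (hq : a q < b q) :
    toLex a < toLex b :=
  Finsupp.Lex.lt_iff.mpr ⟨q, h, hq⟩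

/-- Where the first differing exponent of two monomials of the same degree is the smaller one,
some later exponent has to be positive. -/
theorem exists_gt_ne_zero_of_lex_lt {a b : Fin n →₀ ℕ} (hdeg : a.degree = b.degree) {q : Fin n}
    (h : ∀ i < q, a i = b i) (hq : a q < b q) : ∃ r, q < r ∧ a r ≠ 0 := by
  by_contra! hcon
  have hle : ∀ i, a i ≤ b i := fun i => by
    rcases lt_trichotomy i q with hi | rfl | hi
    · exact (h i hi).le
    · exact hq.le
    · simp [hcon i hi]
  rw [Finsupp.degree_eq_sum, Finsupp.degree_eq_sum] at hdeg
  exact (Finset.sum_lt_sum (fun i _ => hle i) ⟨q, Finset.mem_univ q, hq⟩).ne hdeg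

theorem exists_least {S : Set (Fin n)} (hS : S.Nonempty) : ∃ k ∈ S, ∀ i < k, i ∉ S := by
  obtain ⟨k, hk, hmin⟩ := wellFounded_lt.has_min S hS
  exact ⟨k, hk, fun i hi hiS => hmin i hiS hi⟩

theorem apply_zero_le_of_lex_le [NeZero n] {a b : Fin n →₀ ℕ} (h : toLex a ≤ toLex b) :
    a 0 ≤ b 0 := by
  by_contra! hcon
  exact absurd h (not_le.mpr (lex_lt_of 0 (fun i hi => absurd hi (by simp)) hcon))

theorem eq_of_le_of_degree_eq {a b : Fin n →₀ ℕ} (h : a ≤ b) (hdeg : a.degree = b.degree) :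
    a = b := by
  obtain ⟨c, rfl⟩ := exists_add_of_le h
  rw [map_add, left_eq_add, Finsupp.degree_eq_zero_iff] at hdeg
  rw [hdeg, add_zero]

theorem le_add_single_of_eq_zero {z m : Fin n →₀ ℕ} {p : Fin n}
    (hz : z ≤ m + Finsupp.single p 1) (hp : z p ≤ m p) : z ≤ m := by
  intro i
  rcases eq_or_ne i p with rfl | hi
  · exact hp
  · simpa [Finsupp.single_apply, hi.symm] using hz i

/-- Two monomials of degree `d` are compared as `v ≤ y` once `y` agrees before `x_j` with some
`z ≥ v` and has no variable after `x_k`, while `v` involves none of the variables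
`x_j, …, x_{k-1}`. -/
theorem lex_le_of_filled {d : ℕ} {v y z : Fin n →₀ ℕ} (hv : v.degree = d) (hy : y.degree = d)
    (hvz : toLex v ≤ toLex z) {j k : Fin n} (hyz : ∀ i < j, y i = z i)
    (hvjk : ∀ i, j ≤ i → i < k → v i = 0) (hyk : ∀ i, k < i → y i = 0) :
    toLex v ≤ toLex y := by
  by_contra! hlt
  obtain ⟨q, hq, hlt⟩ := exists_lex_lt hlt
  obtain ⟨r, hqr, hr⟩ := exists_gt_ne_zero_of_lex_lt (hy.trans hv.symm) hq hlt
  have hrk : r ≤ k := not_lt.mp fun h => hr (hyk r h)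
  by_cases hqj : q < j
  · refine absurd hvz (not_le.mpr (lex_lt_of q (fun i hi => ?_) ?_))
    · rw [← hyz i (hi.trans hqj), hq i hi]
    · rwa [← hyz q hqj]
  · rw [hvjk q (not_lt.mp hqj) (hqr.trans_le hrk)] at hlt
    exact absurd hlt (Nat.not_lt_zero _)

theorem degree_le_of_mem_upperClosure_lexsegment {d : ℕ} {u v m : Fin n →₀ ℕ}
    (h : m ∈ upperClosure (lexsegment d u v)) : d ≤ m.degree := by
  obtain ⟨z, ⟨hz, -⟩, hzm⟩ := h
  exact hz ▸ Finsupp.degree_mono hzm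

end Lex

/-! ### The two parts of a lexsegment set -/

section Segments

variable {n : ℕ} [NeZero n] {d : ℕ} {u v : Fin n →₀ ℕ}

/-- The monomials of degree `d` in `x₂, …, xₙ` that are at least `v`. -/
def tailSegment (d : ℕ) (v : Fin n →₀ ℕ) : Set (Fin n →₀ ℕ) :=
  {z | z.degree = d ∧ z 0 = 0 ∧ toLex v ≤ toLex z}

/-- The monomials of degree `d` that are at most `u` and have exponent one at `x₁`. -/
def headSegment (d : ℕ) (u : Fin n →₀ ℕ) : Set (Fin n →₀ ℕ) :=
  {z | z.degree = d ∧ z 0 = 1 ∧ toLex z ≤ toLex u}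

theorem lexsegment_eq_union (hu0 : u 0 = 1) (hv0 : v 0 = 0) :
    lexsegment d u v = tailSegment d v ∪ headSegment d u := by
  ext z
  constructor
  · rintro ⟨hz, hzu, hvz⟩
    have h := apply_zero_le_of_lex_le hzu
    rcases Nat.le_one_iff_eq_zero_or_eq_one.mp (hu0 ▸ h) with h0 | h0
    · exact Or.inl ⟨hz, h0, hvz⟩
    · exact Or.inr ⟨hz, h0, hzu⟩
  · rintro (⟨hz, h0, hvz⟩ | ⟨hz, h0, hzu⟩)
    · exact ⟨hz, (lex_lt_of 0 (fun i hi => absurd hi (by simp)) (by omega)).le, hvz⟩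
    · exact ⟨hz, hzu, (lex_lt_of 0 (fun i hi => absurd hi (by simp)) (by omega)).le⟩

theorem mem_upperClosure_lexsegment_iff (hu0 : u 0 = 1) (hv0 : v 0 = 0) {m : Fin n →₀ ℕ} :
    m ∈ upperClosure (lexsegment d u v) ↔
      m ∈ upperClosure (tailSegment d v) ∨ m ∈ upperClosure (headSegment d u) := by
  rw [lexsegment_eq_union hu0 hv0]
  simp only [mem_upperClosure, Set.mem_union, or_and_right, exists_or]

theorem mem_tail_of_le {m m' : Fin n →₀ ℕ} (h : m ∈ upperClosure (tailSegment d v))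
    (hle : ∀ i ≠ 0, m i ≤ m' i) : m' ∈ upperClosure (tailSegment d v) := by
  obtain ⟨z, hz, hzm⟩ := h
  refine ⟨z, hz, fun i => ?_⟩
  rcases eq_or_ne i 0 with rfl | hi
  · simp [hz.2.1]
  · exact (hzm i).trans (hle i hi)

/-- A monomial whose exponents do not exceed those of `v` before `x_j`, and are smaller at `x_j`, is
divisible by no monomial in `x₂, …, xₙ` that is at least `v`, whatever its later exponents. -/
theorem notMem_tail {m : Fin n →₀ ℕ} {j : Fin n} (h : ∀ i < j, m i ≤ v i ∨ i = 0) (hj : m j < v j) :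
    m ∉ upperClosure (tailSegment d v) := by
  rintro ⟨z, ⟨-, hz0, hvz⟩, hzm⟩
  have hzj : z j < v j := (hzm j).trans_lt hj
  have hzi : ∀ i < j, z i ≤ v i := fun i hi => by
    rcases h i hi with h | rfl
    · exact (hzm i).trans h
    · simp [hz0]
  rcases hvz.eq_or_lt with heq | hlt
  · rw [toLex.injective heq] at hzj
    exact lt_irrefl _ hzj
  · obtain ⟨q, hq, hlt⟩ := exists_lex_lt hlt
    rcases lt_trichotomy q j with hqj | rfl | hqj
    · exact absurd hlt (not_lt.mpr (hzi q hqj))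
    · exact absurd hlt hzj.not_gt
    · exact absurd (hq j hqj) hzj.ne'

/-- Stability of the ideal of the tail segment: if `x_j` pushes a monomial into it, so does every
larger variable except possibly `x₁`. -/
theorem add_single_mem_tail_of_le {m : Fin n →₀ ℕ} {i j : Fin n} (hi : 0 < i) (hij : i ≤ j)
    (hm : m ∉ upperClosure (tailSegment d v))
    (hmj : m + Finsupp.single j 1 ∈ upperClosure (tailSegment d v)) :
    m + Finsupp.single i 1 ∈ upperClosure (tailSegment d v) := by
  obtain ⟨z, ⟨hz, hz0, hvz⟩, hzm⟩ := hmj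
  have hzj : 1 ≤ z j := by
    by_contra! h
    exact hm ⟨z, ⟨hz, hz0, hvz⟩, le_add_single_of_eq_zero hzm (by omega)⟩
  obtain ⟨z₀, rfl⟩ := exists_add_of_le (Finsupp.single_le_iff.mpr hzj)
  rw [add_comm (Finsupp.single j 1)] at *
  refine ⟨z₀ + Finsupp.single i 1, ⟨?_, ?_, hvz.trans ?_⟩, ?_⟩
  · rw [map_add, Finsupp.degree_single] at hz ⊢
    exact hz
  · have : z₀ 0 = 0 := by simpa using (Nat.add_eq_zero_iff.mp hz0).1
    simp [this, hi.ne']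
  · exact add_le_add_right (Finsupp.Lex.single_le_iff.mpr hij) (toLex z₀)
  · exact add_le_add_left (le_of_add_le_add_right hzm) _

/-- If `z ≥ v` divides `m` as far as the variables before `x_j` are concerned, and `v` involves
none of `x_j, …, x_{k-1}`, a `d`-th power of `x_k` makes up for the remaining variables. -/
theorem mem_tail_of_filled (hv : v.degree = d) {m z : Fin n →₀ ℕ} {j k : Fin n} (hk : 0 < k)
    (hjk : j ≤ k) (hz : z ∈ tailSegment d v) (hvjk : ∀ i, j ≤ i → i < k → v i = 0)
    (hm : ∀ i < j, z i ≤ m i) (hmk : d ≤ m k) : m ∈ upperClosure (tailSegment d v) := by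
  classical
  obtain ⟨hzd, hz0, hvz⟩ := hz
  let y₀ : Fin n →₀ ℕ := z.filter (· < j)
  have hy₀ : ∀ i, y₀ i = if i < j then z i else 0 := fun i => Finsupp.filter_apply _ _ _
  have hle : y₀ ≤ z := fun i => by
    rw [hy₀]; split_ifs <;> simp
  have hdeg : y₀.degree ≤ d := hzd ▸ Finsupp.degree_mono hle
  have hy : ∀ i, (y₀ + Finsupp.single k (d - y₀.degree)) i =
      (if i < j then z i else 0) + if k = i then d - y₀.degree else 0 := fun i => by
    rw [Finsupp.add_apply, hy₀, Finsupp.single_apply]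
  have hyd : (y₀ + Finsupp.single k (d - y₀.degree)).degree = d := by
    rw [map_add, Finsupp.degree_single]; omega
  refine ⟨y₀ + Finsupp.single k (d - y₀.degree), ⟨hyd, ?_, ?_⟩, ?_⟩
  · rw [hy]; simp [hz0, hk.ne']
  · refine lex_le_of_filled hv hyd hvz (j := j) (k := k) (fun i hi => ?_) hvjk (fun i hi => ?_)
    · rw [hy, if_pos hi, if_neg (hi.trans_le hjk).ne', add_zero]
    · rw [hy, if_neg (hjk.trans_lt hi).not_gt, if_neg hi.ne]
  · intro i
    rw [hy]
    rcases eq_or_ne k i with rfl | hki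
    · rw [if_neg hjk.not_gt]; simp only [if_true]; omega
    · split_ifs with h
      · simpa using hm i h
      · simp

/-- If a monomial is pushed into the ideal of the tail segment by `x_j`, but not by powers of
`x_{j+1}`, then `x_j` divides `v`. -/
theorem ne_zero_of_add_single_mem_tail (hv : v.degree = d) {m : Fin n →₀ ℕ} {j k : Fin n}
    (hjk : (k : ℕ) = j + 1)
    (hj : m + Finsupp.single j 1 ∈ upperClosure (tailSegment d v))
    (hk : m + Finsupp.single k d ∉ upperClosure (tailSegment d v)) : v j ≠ 0 := by
  intro hvj
  obtain ⟨z, hz, hzm⟩ := hj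
  refine hk (mem_tail_of_filled hv (j := j) (k := k) ?_ ?_ hz ?_ ?_ (by simp))
  · exact Fin.lt_def.mpr (by simp [hjk])
  · exact Fin.le_def.mpr (by omega)
  · intro i hji hik
    have : i = j := Fin.ext (by rw [Fin.le_def] at hji; rw [Fin.lt_def] at hik; omega)
    rw [this, hvj]
  · intro i hi
    have := hzm i
    simp only [Finsupp.add_apply, Finsupp.single_apply, if_neg hi.ne'] at this ⊢
    omega

theorem mem_tail_of_le_apply_one (hv : v.degree = d) (hv0 : v 0 = 0) {m : Fin n →₀ ℕ} {k : Fin n}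
    (hk : (k : ℕ) = 1) (hm : d ≤ m k) : m ∈ upperClosure (tailSegment d v) := by
  refine mem_tail_of_filled hv (j := k) (k := k) (Fin.lt_def.mpr (by simp [hk])) le_rfl
    ⟨hv, hv0, le_rfl⟩ (fun i h1 h2 => absurd h2 h1.not_gt) (fun i hi => ?_) hm
  have : i = 0 := by rw [Fin.lt_def] at hi; exact Fin.val_eq_zero_iff.mp (by omega)
  rw [this, hv0]
  exact Nat.zero_le _

theorem notMem_head_of_apply_zero {m : Fin n →₀ ℕ} (h : m 0 = 0) :
    m ∉ upperClosure (headSegment d u) := by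
  rintro ⟨z, ⟨-, hz, -⟩, hzm⟩
  have := hzm 0
  omega

variable {l : Fin n}

theorem apply_eq_zero_of_mem_head (hu0 : u 0 = 1) (hul : ∀ i, 0 < i → i < l → u i = 0)
    {z : Fin n →₀ ℕ} (hz : z ∈ headSegment d u) {i : Fin n} (hi : 0 < i) (hil : i < l) :
    z i = 0 := by
  obtain ⟨-, hz0, hzu⟩ := hz
  rcases hzu.eq_or_lt with heq | hlt
  · rw [toLex.injective heq, hul i hi hil]
  · obtain ⟨q, hq, hlt⟩ := exists_lex_lt hlt
    rcases lt_or_ge i q with hiq | hqi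
    · rw [hq i hiq, hul i hi hil]
    · have hq0 : 0 < q := by
        rw [Fin.pos_iff_ne_zero]
        rintro rfl
        omega
      rw [hul q hq0 (hqi.trans_lt hil)] at hlt
      exact absurd hlt (Nat.not_lt_zero _)

theorem mem_head_of_add_single (hu0 : u 0 = 1) (hul : ∀ i, 0 < i → i < l → u i = 0)
    {m : Fin n →₀ ℕ} {i : Fin n} (hi : 0 < i) (hil : i < l)
    (h : m + Finsupp.single i 1 ∈ upperClosure (headSegment d u)) :
    m ∈ upperClosure (headSegment d u) := by
  obtain ⟨z, hz, hzm⟩ := h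
  refine ⟨z, hz, le_add_single_of_eq_zero hzm ?_⟩
  rw [apply_eq_zero_of_mem_head hu0 hul hz hi hil]
  exact Nat.zero_le _

theorem apply_le_of_mem_head (hu0 : u 0 = 1) (hul : ∀ i, 0 < i → i < l → u i = 0)
    {z : Fin n →₀ ℕ} (hz : z ∈ headSegment d u) : z l ≤ u l := by
  by_contra! hcon
  refine absurd hz.2.2 (not_le.mpr (lex_lt_of l (fun i hi => ?_) hcon))
  rcases (Fin.zero_le i).eq_or_lt with rfl | h0
  · rw [hu0, hz.2.1]
  · rw [apply_eq_zero_of_mem_head hu0 hul hz h0 hi, hul i h0 hi]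

theorem mem_head_of_le_apply (hd : 2 ≤ d) (hu0 : u 0 = 1) (hl : 0 < l) (hl0 : u l ≠ 0)
    (hul : ∀ i, 0 < i → i < l → u i = 0) {m : Fin n →₀ ℕ} {k : Fin n} (hk : l < k)
    (hm0 : 1 ≤ m 0) (hmk : d - 1 ≤ m k) : m ∈ upperClosure (headSegment d u) := by
  have hk0 : k ≠ 0 := (hl.trans hk).ne'
  refine ⟨Finsupp.single 0 1 + Finsupp.single k (d - 1), ⟨?_, ?_, ?_⟩, ?_⟩
  · rw [map_add, Finsupp.degree_single, Finsupp.degree_single]; omega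
  · simp [hk0]
  · refine (lex_lt_of l (fun i hi => ?_) ?_).le
    · rcases (Fin.zero_le i).eq_or_lt with rfl | h0
      · simp [hk0, hu0]
      · simp [h0.ne, (hi.trans hk).ne', hul i h0 hi]
    · simp [hl.ne, hk.ne', Nat.pos_of_ne_zero hl0]
  · intro i
    simp only [Finsupp.add_apply, Finsupp.single_apply]
    split_ifs with h1 h2 h2 <;> subst_vars <;> omega

/-- No monomial `x₁ x_p xₙ^{d-2}` with `p ≥ l` exceeds `u`: the largest of them, `x₁ x_l xₙ^{d-2}`,
is the least multiple of `x₁ x_l` of degree `d`. -/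
theorem add_single_last_mem_head (hd : 2 ≤ d) (hu : u.degree = d) (hu0 : u 0 = 1) (hl : 0 < l)
    (hl0 : u l ≠ 0) {last p : Fin n}
    (hlast : ∀ i, i ≤ last) (hp : l ≤ p) :
    Finsupp.single 0 1 + Finsupp.single p 1 + Finsupp.single last (d - 2) ∈ headSegment d u := by
  have hp0 : p ≠ 0 := (hl.trans_le hp).ne'
  have hlast0 : last ≠ 0 := (hl.trans_le (hlast l)).ne'
  have hdeg : (Finsupp.single 0 1 + Finsupp.single p 1 + Finsupp.single last (d - 2) :
      Fin n →₀ ℕ).degree = d := by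
    simp only [map_add, Finsupp.degree_single]; omega
  refine ⟨hdeg, by simp [hp0, hlast0], ?_⟩
  by_contra! hlt
  obtain ⟨q, hq, hlt⟩ := exists_lex_lt hlt
  obtain ⟨r, hqr, -⟩ := exists_gt_ne_zero_of_lex_lt (hu.trans hdeg.symm) hq hlt
  have hqlast : q < last := hqr.trans_le (hlast r)
  have hq0 : q ≠ 0 := by
    rintro rfl
    simp [hu0, hp0, hlast0] at hlt
  have hpq : p = q := by
    by_contra hne
    simp [hq0.symm, hne, hqlast.ne'] at hlt
  subst hpq
  have hlp : l ≠ p := by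
    rintro rfl
    simp [hl.ne, hqlast.ne'] at hlt
    exact hl0 hlt
  have hlq : l < p := lt_of_le_of_ne hp hlp
  have := hq l hlq
  simp [hl.ne, hlp.symm, (hlq.trans hqlast).ne'] at this
  exact hl0 this

end Segments

/-! ### Witnesses for the associated primes -/

section Witnesses

variable {n : ℕ} [NeZero n] {d : ℕ} {u v : Fin n →₀ ℕ} {l : Fin n}

/-- The standing assumptions once `u` is known to have exponent one at `x₁`; the variable `x_l` is
the largest one dividing `u / x₁`. -/
structure NormalForm (d : ℕ) (u v : Fin n →₀ ℕ) (l : Fin n) : Prop where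
  two_le : 2 ≤ d
  degree_u : u.degree = d
  degree_v : v.degree = d
  u_zero : u 0 = 1
  v_zero : v 0 = 0
  l_pos : 0 < l
  u_l : u l ≠ 0
  u_between : ∀ i, 0 < i → i < l → u i = 0

theorem NormalForm.mem_iff (h : NormalForm d u v l) {m : Fin n →₀ ℕ} :
    m ∈ upperClosure (lexsegment d u v) ↔
      m ∈ upperClosure (tailSegment d v) ∨ m ∈ upperClosure (headSegment d u) :=
  mem_upperClosure_lexsegment_iff h.u_zero h.v_zero

theorem NormalForm.u_mem (h : NormalForm d u v l) : u ∈ headSegment d u :=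
  ⟨h.degree_u, h.u_zero, le_rfl⟩

theorem exists_last (n : ℕ) [NeZero n] : ∃ k : Fin n, (k : ℕ) = n - 1 ∧ ∀ i, i ≤ k :=
  ⟨⟨n - 1, Nat.sub_lt (Nat.pos_of_ne_zero (NeZero.ne n)) one_pos⟩, rfl, fun i =>
    Fin.le_def.mpr (Nat.le_sub_one_of_lt i.2)⟩

theorem add_single_mem_tail_of_prefix (hv : v.degree = d) (hv0 : v 0 = 0) {j k : Fin n}
    (hjk : (k : ℕ) = j + 1) {m : Fin n →₀ ℕ} (hlt : ∀ i < j, i ≠ 0 → m i = v i)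
    (hj : m j = v j - 1) (hk : d ≤ m k) {i : Fin n} (hi : 0 < i) (hij : i ≤ j) (hvj : v j ≠ 0) :
    m + Finsupp.single i 1 ∈ upperClosure (tailSegment d v) := by
  refine add_single_mem_tail_of_le hi hij (notMem_tail (j := j) (fun i hi => ?_) (by omega)) ?_
  · by_cases h0 : i = 0
    · exact Or.inr h0
    · exact Or.inl (hlt i hi h0).le
  · refine mem_tail_of_filled hv (j := k) (k := k) (Fin.lt_def.mpr (by simp [hjk])) le_rfl
      ⟨hv, hv0, le_rfl⟩ (fun i h1 h2 => absurd h2 h1.not_gt) (fun i hi => ?_) ?_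
    · rcases eq_or_ne i 0 with rfl | h0
      · simp [hv0]
      rcases eq_or_ne i j with rfl | hne
      · simp [hj]; omega
      · have : i < j := lt_of_le_of_ne (Fin.le_def.mpr (by rw [Fin.lt_def] at hi; omega)) hne
        simp [hlt i this h0]
    · exact hk.trans (by simp)

theorem add_notMem_tail_of_prefix {j : Fin n} {m y : Fin n →₀ ℕ}
    (hlt : ∀ i < j, i ≠ 0 → m i = v i) (hj : m j = v j - 1) (hvj : v j ≠ 0)
    (hy : ∀ i, i ≠ 0 → i ≤ j → y i = 0) (hj0 : j ≠ 0) :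
    m + y ∉ upperClosure (tailSegment d v) := by
  refine notMem_tail (j := j) (fun i hi => ?_) ?_
  · by_cases h0 : i = 0
    · exact Or.inr h0
    · exact Or.inl (by simp [hlt i hi h0, hy i h0 hi.le])
  · simp [hj, hy j hj0 le_rfl]; omega

theorem NormalForm.ne_zero_of_mem_supp (h : NormalForm d u v l) {j : Fin n} (hj : v j ≠ 0) :
    j ≠ 0 := by
  rintro rfl
  exact hj h.v_zero

/-- The witness for `(x₁, …, x_j)` agrees with `v` before `x_j`, has one factor `x_j` less than
`v`, and is large after `x_j`. -/
theorem NormalForm.exists_isColon_initial (h : NormalForm d u v l) {j : Fin n} (hj : v j ≠ 0)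
    (hjn : (j : ℕ) ≠ n - 1) :
    ∃ m, IsColon (lexsegment d u v) m {i | i ≤ j} := by
  obtain ⟨m, hm⟩ : ∃ m : Fin n →₀ ℕ, ∀ i, m i =
      if i < j then v i else if i = j then v j - 1 else d :=
    ⟨Finsupp.equivFunOnFinite.symm _, fun _ => rfl⟩
  have hj0 := h.ne_zero_of_mem_supp hj
  have hj0' := Fin.pos_iff_ne_zero.mpr hj0
  have hlt : ∀ i < j, i ≠ 0 → m i = v i := fun i hi _ => by rw [hm, if_pos hi]
  have hmj : m j = v j - 1 := by rw [hm]; simp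
  have hgt : ∀ i, j < i → m i = d := fun i hi => by
    rw [hm, if_neg hi.not_gt, if_neg hi.ne']
  have hm0 : m 0 = 0 := by rw [hm, if_pos hj0', h.v_zero]
  obtain ⟨last, hlast, hle⟩ := exists_last n
  have hjlt : (j : ℕ) < n - 1 := by omega
  refine ⟨m, fun i hi => ?_, fun y hy => ?_⟩
  · rw [h.mem_iff]
    rcases eq_or_ne i 0 with rfl | hi0
    · right
      refine ⟨_, add_single_last_mem_head h.two_le h.degree_u h.u_zero h.l_pos h.u_l hle (hle l),
        ?_⟩
      have hl0 : last ≠ 0 := (hj0'.trans (Fin.lt_def.mpr (by omega))).ne'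
      have hml := hgt last (Fin.lt_def.mpr (by omega))
      have := h.two_le
      intro k
      rcases eq_or_ne k 0 with rfl | hk0
      · simp [hl0]
      rcases eq_or_ne k last with rfl | hkl
      · simp [hk0.symm, hml]; omega
      · simp [hk0.symm, hkl.symm]
    · left
      exact add_single_mem_tail_of_prefix h.degree_v h.v_zero (k := ⟨j + 1, by omega⟩) rfl hlt hmj
        (hgt _ (Fin.lt_def.mpr (by simp))).ge (Fin.pos_iff_ne_zero.mpr hi0) hi hj
  · rw [h.mem_iff, not_or]
    refine ⟨add_notMem_tail_of_prefix hlt hmj hj (fun i _ hi => hy i hi) hj0,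
      notMem_head_of_apply_zero ?_⟩
    simp [hm0, hy 0 (Fin.zero_le j)]

/-- Let `x^t` be such that, up to factors in the variables before `x_c`, it is not in the ideal of
the head segment but is pushed into it by each variable from `x_c` on. For `j` in the support of
`v` with `j + 2 ≤ c`, the prime `(x₂, …, x_j, x_c, …, xₙ)` is then of the form `(I : x^m)`: take
`m` to be `1` at `x₁`, equal to `v` with one factor `x_j` removed up to `x_j`, large between `x_j`
and `x_c`, and equal to `t` from `x_c` on. -/
theorem NormalForm.exists_isColon_mixed (h : NormalForm d u v l) {j : Fin n} {c : ℕ}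
    (hj : v j ≠ 0) (hjc : (j : ℕ) + 2 ≤ c) (hcl : c ≤ l + 1) (t : Fin n →₀ ℕ)
    (hmem : ∀ i : Fin n, c ≤ i → ∃ z ∈ headSegment d u,
      ∀ k : Fin n, c ≤ k → z k ≤ (t + Finsupp.single i 1 : Fin n →₀ ℕ) k)
    (hnot : ∀ z ∈ headSegment d u, ∃ k : Fin n, c ≤ k ∧ t k < z k) :
    ∃ m, IsColon (lexsegment d u v) m {i : Fin n | (1 ≤ (i : ℕ) ∧ (i : ℕ) ≤ j) ∨ c ≤ (i : ℕ)} := by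
  obtain ⟨m, hm⟩ : ∃ m : Fin n →₀ ℕ, ∀ i, m i = if i = 0 then 1 else if i < j then v i else
      if i = j then v j - 1 else if (i : ℕ) < c then d else t i :=
    ⟨Finsupp.equivFunOnFinite.symm _, fun _ => rfl⟩
  have hj0 := h.ne_zero_of_mem_supp hj
  have hlt : ∀ i < j, i ≠ 0 → m i = v i := fun i hi h0 => by rw [hm, if_neg h0, if_pos hi]
  have hmj : m j = v j - 1 := by rw [hm]; simp [hj0]
  have hmid : ∀ i, j < i → (i : ℕ) < c → m i = d := fun i hi hic => by
    rw [hm, if_neg ((Fin.zero_le j).trans_lt hi).ne', if_neg hi.not_gt, if_neg hi.ne', if_pos hic]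
  have hge : ∀ i : Fin n, c ≤ i → m i = t i := fun i hi => by
    have hji : j < i := Fin.lt_def.mpr (by omega)
    rw [hm, if_neg ((Fin.zero_le j).trans_lt hji).ne', if_neg hji.not_gt, if_neg hji.ne',
      if_neg hi.not_gt]
  have hm0 : m 0 = 1 := by rw [hm]; simp
  have hcn : c < n := by
    obtain ⟨k, hk, -⟩ := hnot u h.u_mem
    exact hk.trans_lt k.2
  refine ⟨m, fun i hi => ?_, fun y hy => ?_⟩
  · rw [h.mem_iff]
    rcases hi with ⟨hi1, hij⟩ | hi
    · left
      exact add_single_mem_tail_of_prefix h.degree_v h.v_zero (k := ⟨j + 1, by omega⟩) rfl hlt hmj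
        (hmid _ (Fin.lt_def.mpr (by simp)) (by simp; omega)).ge (Fin.pos_iff_ne_zero.mpr
          (by rintro rfl; simp at hi1)) hij hj
    · right
      obtain ⟨z, hz, hzk⟩ := hmem i hi
      refine ⟨z, hz, fun k => ?_⟩
      rcases le_or_gt c k with hck | hck
      · simpa [hge k hck] using hzk k hck
      rcases eq_or_ne k 0 with rfl | hk0
      · simp [hm0, hz.2.1]
      rcases lt_or_ge k l with hkl | hkl
      · rw [apply_eq_zero_of_mem_head h.u_zero h.u_between hz (Fin.pos_iff_ne_zero.mpr hk0) hkl]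
        exact Nat.zero_le _
      · rw [Fin.le_def] at hkl
        have h1 : m k = d := hmid k (Fin.lt_def.mpr (by omega)) hck
        have h2 : z k ≤ d := hz.1 ▸ Finsupp.le_degree k z
        simp [h1]; omega
  · rw [h.mem_iff, not_or]
    refine ⟨add_notMem_tail_of_prefix hlt hmj hj (fun i hi0 hij => hy i (Or.inl ⟨?_, hij⟩)) hj0, ?_⟩
    · exact Nat.one_le_iff_ne_zero.mpr fun h0 => hi0 (Fin.val_eq_zero_iff.mp h0)
    · rintro ⟨z, hz, hzm⟩
      obtain ⟨k, hck, hk⟩ := hnot z hz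
      have := hzm k
      rw [Finsupp.add_apply, hge k hck, hy k (Or.inr hck)] at this
      omega

theorem NormalForm.exists_isColon_mixed_l (h : NormalForm d u v l) {j : Fin n}
    (hj : v j ≠ 0) (hjl : (j : ℕ) + 2 ≤ l) :
    ∃ m, IsColon (lexsegment d u v) m
      {i : Fin n | (1 ≤ (i : ℕ) ∧ (i : ℕ) ≤ j) ∨ (l : ℕ) ≤ (i : ℕ)} := by
  obtain ⟨last, -, hle⟩ := exists_last n
  refine h.exists_isColon_mixed hj hjl (Nat.le_succ _) (Finsupp.single last (d - 2))
    (fun i hi => ⟨_, add_single_last_mem_head h.two_le h.degree_u h.u_zero h.l_pos h.u_l hle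
      (Fin.le_def.mpr hi), fun k hk => ?_⟩) fun z hz => ?_
  · have hk0 : k ≠ 0 := (h.l_pos.trans_le (Fin.le_def.mpr hk)).ne'
    simp [hk0.symm, add_comm]
  · by_contra! hcon
    have hle : z ≤ Finsupp.single 0 1 + Finsupp.single last (d - 2) := by
      intro k
      rcases eq_or_ne k 0 with rfl | hk0
      · simp [hz.2.1]
      rcases lt_or_ge k l with hkl | hkl
      · rw [apply_eq_zero_of_mem_head h.u_zero h.u_between hz (Fin.pos_iff_ne_zero.mpr hk0) hkl]
        exact Nat.zero_le _
      · exact (hcon k (Fin.le_def.mp hkl)).trans (by simp)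
    have := Finsupp.degree_mono hle
    rw [hz.1, map_add, Finsupp.degree_single, Finsupp.degree_single] at this
    have := h.two_le
    omega

theorem NormalForm.exists_isColon_mixed_l_succ (h : NormalForm d u v l) (hul : u l < d - 1)
    {j : Fin n} (hj : v j ≠ 0) (hjl : (j : ℕ) + 1 ≤ l) :
    ∃ m, IsColon (lexsegment d u v) m
      {i : Fin n | (1 ≤ (i : ℕ) ∧ (i : ℕ) ≤ j) ∨ (l : ℕ) + 1 ≤ (i : ℕ)} := by
  classical
  -- The monomials in the variables after `x_l` that no monomial in the variables up to `x_l` pushes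
  -- into the ideal of the head segment. They are finite in number, as that ideal contains
  -- `x₁ x_k^{d-1}` for `k > l`, and a maximal one has the required property.
  let T : Set (Fin n →₀ ℕ) := {t | (∀ i ≤ l, t i = 0) ∧
    ∀ z ∈ headSegment d u, ∃ k : Fin n, (l : ℕ) + 1 ≤ k ∧ t k < z k}
  have hfin : T.Finite := by
    refine (Set.finite_Icc 0 (Finsupp.equivFunOnFinite.symm fun _ => d)).subset ?_
    rintro t ⟨ht0, ht⟩
    refine ⟨zero_le, fun i => ?_⟩
    change t i ≤ d
    by_contra! hcon
    have hli : l < i := not_le.mp fun hi => by rw [ht0 i hi] at hcon; omega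
    obtain ⟨z, hz, hzt⟩ := mem_head_of_le_apply (m := Finsupp.single 0 1 + t) h.two_le h.u_zero
      h.l_pos h.u_l h.u_between hli (by simp) (by simp; omega)
    obtain ⟨k, hk, hlt⟩ := ht z hz
    have hk0 : k ≠ 0 := (h.l_pos.trans (Fin.lt_def.mpr hk)).ne'
    have := hzt k
    simp [hk0.symm] at this
    omega
  have hne : T.Nonempty := by
    refine ⟨0, fun _ _ => rfl, fun z hz => ?_⟩
    by_contra! hcon
    have hle : z ≤ Finsupp.single 0 1 + Finsupp.single l (u l) := by
      intro k
      rcases eq_or_ne k 0 with rfl | hk0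
      · simp [hz.2.1]
      rcases lt_trichotomy k l with hkl | rfl | hkl
      · rw [apply_eq_zero_of_mem_head h.u_zero h.u_between hz (Fin.pos_iff_ne_zero.mpr hk0) hkl]
        exact Nat.zero_le _
      · simpa using (apply_le_of_mem_head h.u_zero h.u_between hz).trans (Nat.le_add_left _ _)
      · exact (hcon k (Fin.lt_def.mp hkl)).trans (Nat.zero_le _)
    have := Finsupp.degree_mono hle
    rw [hz.1, map_add, Finsupp.degree_single, Finsupp.degree_single] at this
    omega
  obtain ⟨t, ⟨ht0, ht⟩, hmax⟩ := hfin.exists_maximal hne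
  refine h.exists_isColon_mixed hj (by omega) le_rfl t (fun i hi => ?_) ht
  by_contra! hcon
  have hmem : t + Finsupp.single i 1 ∈ T := by
    refine ⟨fun k hk => ?_, hcon⟩
    have hki : i ≠ k := by rintro rfl; rw [Fin.le_def] at hk; omega
    simp [ht0 k hk, hki.symm]
  have := hmax hmem (le_add_of_nonneg_right zero_le) i
  simp at this

/-! ### Shape of the associated primes -/

theorem NormalForm.eq_zero_of_add_single_zero_mem (h : NormalForm d u v l) {m : Fin n →₀ ℕ}
    (hm : m ∉ upperClosure (lexsegment d u v))
    (hm0 : m + Finsupp.single 0 1 ∈ upperClosure (lexsegment d u v)) : m 0 = 0 := by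
  rw [h.mem_iff] at hm hm0
  rw [not_or] at hm
  by_contra hne
  rcases hm0 with h1 | ⟨z, hz, hzm⟩
  · exact hm.1 (mem_tail_of_le h1 fun i hi => by simp [hi.symm])
  · refine hm.2 ⟨z, hz, le_add_single_of_eq_zero hzm ?_⟩
    rw [hz.2.1]
    omega

/-- A prime `(I : x^m)` that contains `x₁` is of the form `(x₁, …, x_j)` with `x_j ∣ v`: the
exponent of `x₁` in `x^m` has to be zero, so that the other variables in the prime push `x^m` into
the ideal of the tail segment. -/
theorem NormalForm.isColon_zero_mem (h : NormalForm d u v l) {m : Fin n →₀ ℕ} {F : Set (Fin n)}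
    (hF : IsColon (lexsegment d u v) m F) (h0 : 0 ∈ F) (huniv : F ≠ Set.univ) :
    ∃ j, v j ≠ 0 ∧ (j : ℕ) ≠ n - 1 ∧ F = {i | i ≤ j} := by
  have hm0 := h.eq_zero_of_add_single_zero_mem hF.notMem (hF.1 0 h0)
  have htail : ∀ {i}, i ≠ 0 → (m + Finsupp.single i 1 ∈ upperClosure (lexsegment d u v) ↔
      m + Finsupp.single i 1 ∈ upperClosure (tailSegment d v)) := fun {i} hi => by
    rw [h.mem_iff]
    exact or_iff_left (notMem_head_of_apply_zero (by simp [hm0, hi]))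
  have hnot := fun {m'} (h1 : m' ∉ upperClosure (lexsegment d u v)) =>
    (not_or.mp (h.mem_iff.not.mp h1)).1
  obtain ⟨k, hk, hmin⟩ := exists_least (Set.nonempty_compl.mpr huniv)
  have hk0 : k ≠ 0 := by rintro rfl; exact hk h0
  have hk1 : (k : ℕ) ≠ 1 := fun h1 => hnot (hF.add_single_notMem hk d)
    (mem_tail_of_le_apply_one h.degree_v h.v_zero h1 (by simp))
  have hk0' : (k : ℕ) ≠ 0 := fun h1 => hk0 (Fin.val_eq_zero_iff.mp h1)
  have hkn := k.2
  let j : Fin n := ⟨k - 1, by omega⟩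
  have hjk : (k : ℕ) = j + 1 := by simp only [j]; omega
  have hj0 : j ≠ 0 := fun h1 => by rw [h1] at hjk; simp at hjk; omega
  have hjF : j ∈ F := not_not.mp (hmin j (Fin.lt_def.mpr (by omega)))
  refine ⟨j, ne_zero_of_add_single_mem_tail h.degree_v hjk ((htail hj0).mp (hF.1 j hjF))
    (hnot (hF.add_single_notMem hk d)), by omega, ?_⟩
  ext i
  constructor
  · intro hi
    by_contra hij
    have hki : k ≤ i := Fin.le_def.mpr (by
      rw [Set.mem_ofPred_eq, not_le, Fin.lt_def] at hij; omega)
    have hi0 : i ≠ 0 := ((Fin.pos_iff_ne_zero.mpr hk0).trans_le hki).ne'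
    exact hnot (hF.add_single_notMem hk 1) (add_single_mem_tail_of_le (Fin.pos_iff_ne_zero.mpr hk0)
      hki (hnot hF.notMem) ((htail hi0).mp (hF.1 i hi)))
  · intro hi
    exact not_not.mp (hmin i (Fin.lt_def.mpr (by rw [Set.mem_ofPred_eq, Fin.le_def] at hi; omega)))

/-- A prime `(I : x^m)` that does not contain `x₁` contains all variables after `x_l`. Its
variables strictly between `x₁` and `x_l` push `x^m` into the ideal of the tail segment, so they
form an initial part `x₂, …, x_j`. -/
theorem NormalForm.isColon_zero_notMem (h : NormalForm d u v l) {m : Fin n →₀ ℕ} {F : Set (Fin n)}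
    (hF' : IsColon (lexsegment d u v) m F) (h0 : 0 ∉ F) :
    F = {i : Fin n | 1 ≤ (i : ℕ)} ∨
    (∃ j, v j ≠ 0 ∧ (j : ℕ) + 2 ≤ l ∧
      F = {i : Fin n | (1 ≤ (i : ℕ) ∧ (i : ℕ) ≤ j) ∨ (l : ℕ) ≤ (i : ℕ)}) ∨
    (∃ j, v j ≠ 0 ∧ (j : ℕ) + 1 ≤ l ∧ u l ≠ d - 1 ∧
      F = {i : Fin n | (1 ≤ (i : ℕ) ∧ (i : ℕ) ≤ j) ∨ (l : ℕ) + 1 ≤ (i : ℕ)}) := by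
  -- Since `x₁` is not in the prime, the witness may be multiplied by `x₁`.
  obtain ⟨m, hm0, hF⟩ : ∃ m : Fin n →₀ ℕ, 1 ≤ m 0 ∧ IsColon (lexsegment d u v) m F := by
    refine ⟨m + Finsupp.single 0 1, by simp, fun i hi => ?_, fun y hy => ?_⟩
    · rw [add_right_comm]
      exact (upperClosure _).upper (le_add_of_nonneg_right zero_le) (hF'.1 i hi)
    · rw [add_assoc]
      refine hF'.2 _ fun i hi => ?_
      have hi0 : i ≠ 0 := by rintro rfl; exact h0 hi
      simp [hy i hi, hi0]
  have htail := fun {m'} (h1 : m' ∉ upperClosure (lexsegment d u v)) =>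
    (not_or.mp (h.mem_iff.not.mp h1)).1
  have hhead := fun {m'} (h1 : m' ∉ upperClosure (lexsegment d u v)) =>
    (not_or.mp (h.mem_iff.not.mp h1)).2
  have hval : ∀ i : Fin n, i ≠ 0 → 1 ≤ (i : ℕ) := fun i hi =>
    Nat.one_le_iff_ne_zero.mpr fun h1 => hi (Fin.val_eq_zero_iff.mp h1)
  have hgt : ∀ i, l < i → i ∈ F := fun i hi => by
    by_contra hiF
    exact hhead (hF.add_single_notMem hiF d) (mem_head_of_le_apply h.two_le h.u_zero h.l_pos h.u_l
      h.u_between hi (hm0.trans (by simp)) (by simp; omega))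
  by_cases hall : ∀ i, i ≠ 0 → i ∈ F
  · left
    ext i
    refine ⟨fun hi => hval i (by rintro rfl; exact h0 hi), fun hi => hall i ?_⟩
    rintro rfl
    simp at hi
  right
  push Not at hall
  obtain ⟨k, ⟨hk0, hk⟩, hmin⟩ := exists_least (S := {i | i ≠ 0 ∧ i ∉ F}) hall
  have hbelow : ∀ i, i ≠ 0 → i < k → i ∈ F := fun i hi hik => by
    by_contra hiF
    exact hmin i hik ⟨hi, hiF⟩
  have hkl : k ≤ l := not_lt.mp fun hlt => hk (hgt k hlt)
  have hk1 : (k : ℕ) ≠ 1 := fun h1 => htail (hF.add_single_notMem hk d)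
    (mem_tail_of_le_apply_one h.degree_v h.v_zero h1 (by simp))
  have hk1' := hval k hk0
  have hkn := k.2
  let j : Fin n := ⟨k - 1, by omega⟩
  have hjk : (k : ℕ) = j + 1 := by simp only [j]; omega
  have hj0 : j ≠ 0 := fun h1 => by rw [h1] at hjk; simp at hjk; omega
  have hjF : j ∈ F := hbelow j hj0 (Fin.lt_def.mpr (by omega))
  have hkl' := Fin.le_def.mp hkl
  have hmemtail : ∀ i ∈ F, i ≠ 0 → i < l →
      m + Finsupp.single i 1 ∈ upperClosure (tailSegment d v) :=
    fun i hi hi0 hil => by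
      refine (h.mem_iff.mp (hF.1 i hi)).resolve_right fun h1 => hhead hF.notMem ?_
      exact mem_head_of_add_single h.u_zero h.u_between (Fin.pos_iff_ne_zero.mpr hi0) hil h1
  have hvj : v j ≠ 0 := ne_zero_of_add_single_mem_tail h.degree_v hjk
    (hmemtail j hjF hj0 (Fin.lt_def.mpr (by omega))) (htail (hF.add_single_notMem hk d))
  have hmid : ∀ i, k ≤ i → i < l → i ∉ F := fun i hki hil hi => by
    have hi0 : i ≠ 0 := ((Fin.pos_iff_ne_zero.mpr hk0).trans_le hki).ne'
    exact htail (hF.add_single_notMem hk 1) (add_single_mem_tail_of_le (Fin.pos_iff_ne_zero.mpr hk0)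
      hki (htail hF.notMem) (hmemtail i hi hi0 hil))
  have hiff : ∀ i, i ≠ l → (i ∈ F ↔ (1 ≤ (i : ℕ) ∧ (i : ℕ) ≤ j) ∨ (l : ℕ) + 1 ≤ (i : ℕ)) := by
    intro i hil
    constructor
    · intro hi
      have hi0 : i ≠ 0 := by rintro rfl; exact h0 hi
      by_contra! hcon
      have h1 := hcon.1 (hval i hi0)
      exact hmid i (Fin.le_def.mpr (by omega))
        (lt_of_le_of_ne (Fin.le_def.mpr (by omega)) hil) hi
    · rintro (⟨h1, h2⟩ | h1)
      · exact hbelow i (by rintro rfl; simp at h1) (Fin.lt_def.mpr (by omega))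
      · exact hgt i (Fin.lt_def.mpr h1)
  by_cases hlF : l ∈ F
  · left
    have hne : k ≠ l := by rintro rfl; exact hk hlF
    have hlt := Fin.lt_def.mp (lt_of_le_of_ne hkl hne)
    refine ⟨j, hvj, by omega, ?_⟩
    ext i
    rcases eq_or_ne i l with rfl | hil
    · simp [hlF]
    · rw [hiff i hil, Set.mem_ofPred_eq]
      have : (i : ℕ) ≠ l := fun h1 => hil (Fin.ext h1)
      omega
  · right
    refine ⟨j, hvj, by omega, fun hul => ?_, ?_⟩
    · refine hhead (hF.add_single_notMem hlF d) ⟨u, h.u_mem, fun i => ?_⟩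
      have hule : u = Finsupp.single 0 1 + Finsupp.single l (u l) := by
        refine (eq_of_le_of_degree_eq (fun i => ?_) ?_).symm
        · rcases eq_or_ne i 0 with rfl | hi0
          · simp [h.l_pos.ne, h.u_zero]
          rcases eq_or_ne i l with rfl | hil
          · simp [hi0.symm]
          · simp [hi0.symm, hil.symm]
        · rw [map_add, Finsupp.degree_single, Finsupp.degree_single, h.degree_u]
          have := h.two_le
          omega
      rw [hule]
      rcases eq_or_ne i 0 with rfl | hi0
      · simp [h.l_pos.ne, hm0]
      rcases eq_or_ne i l with rfl | hil
      · simp [hi0.symm]; omega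
      · simp [hi0.symm, hil.symm]
    · ext i
      rcases eq_or_ne i l with rfl | hil
      · simp only [hlF, Set.mem_ofPred_eq, false_iff]; omega
      · exact hiff i hil

end Witnesses

/-! ### When `(x₂, …, xₙ)` is an associated prime -/

section TailPrime

variable {n : ℕ} [NeZero n] {d : ℕ} {u v : Fin n →₀ ℕ} {l : Fin n}

theorem lex_le_single {D : ℕ} {z : Fin n →₀ ℕ} (hz : z.degree = D) (hz0 : z 0 = 0) {one : Fin n}
    (hone : (one : ℕ) = 1) : toLex z ≤ toLex (Finsupp.single one D) := by
  by_contra! hlt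
  obtain ⟨q, hq, hlt⟩ := exists_lex_lt hlt
  obtain ⟨r, hqr, hr⟩ := exists_gt_ne_zero_of_lex_lt (by rw [Finsupp.degree_single, hz]) hq hlt
  have hr1 : r = one := by
    by_contra hne
    exact hr (Finsupp.single_eq_of_ne hne)
  have hq0 : q = 0 := by
    rw [hr1, Fin.lt_def] at hqr
    exact Fin.val_eq_zero_iff.mp (by omega)
  rw [hq0, hz0] at hlt
  exact absurd hlt (Nat.not_lt_zero _)

/-- If `v = x₂^{d-1} x_i`, the tail segment involves no variable smaller than `x_i`. -/
theorem apply_eq_zero_of_mem_tail (hd : 2 ≤ d) {one i p : Fin n} (hone : (one : ℕ) = 1)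
    (hv : v = Finsupp.single one (d - 1) + Finsupp.single i 1) (hip : i < p) {z : Fin n →₀ ℕ}
    (hz : z ∈ tailSegment d v) : z p = 0 := by
  obtain ⟨hzd, hz0, hvz⟩ := hz
  by_contra hzp
  obtain ⟨z₀, rfl⟩ := exists_add_of_le
    (Finsupp.single_le_iff.mpr (Nat.one_le_iff_ne_zero.mpr hzp))
  rw [add_comm] at hvz
  have h1 : toLex z₀ ≤ toLex (Finsupp.single one (d - 1)) := by
    refine lex_le_single ?_ (Nat.add_eq_zero_iff.mp hz0).2 hone
    rw [map_add, Finsupp.degree_single] at hzd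
    omega
  have h2 : toLex z₀ + toLex (Finsupp.single p 1) <
      toLex (Finsupp.single one (d - 1)) + toLex (Finsupp.single i 1) :=
    add_lt_add_of_le_of_lt h1 (Finsupp.Lex.single_lt_iff.mpr hip)
  rw [hv] at hvz
  exact absurd hvz (not_le.mpr h2)

/-- Since the generators of the ideal have exponent at most one at `x₁`, powers of `x₁` do not push
into the ideal a monomial outside that is already divisible by `x₁`. -/
theorem NormalForm.isColon_tail (h : NormalForm d u v l) {m : Fin n →₀ ℕ} (hm0 : m 0 = 1)
    (hmem : ∀ i ≠ 0, m + Finsupp.single i 1 ∈ upperClosure (lexsegment d u v))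
    (hnot : m ∉ upperClosure (lexsegment d u v)) :
    IsColon (lexsegment d u v) m {i | 1 ≤ (i : ℕ)} := by
  refine ⟨fun i hi => hmem i (by rintro rfl; simp at hi), fun y hy ⟨z, hz, hzm⟩ => hnot ⟨z, hz, ?_⟩⟩
  intro i
  rcases eq_or_ne i 0 with rfl | hi
  · rw [hm0, ← h.u_zero]
    exact apply_zero_le_of_lex_le hz.2.1
  · have := hzm i
    rwa [Finsupp.add_apply, hy i (Nat.one_le_iff_ne_zero.mpr
      fun h0 => hi (Fin.val_eq_zero_iff.mp h0)), add_zero] at this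

/-- Unless `v = x₂^{d-1} x_i` for an index `i ≤ l - 2`, the prime `(x₂, …, xₙ)` is associated. It
is `(I : u / x₂)` if `l` is the index of `x₂`, it is `(I : x₁ x₂^{d-1})` if `v ≤ x₂^{d-1} xₙ`, and
it is `(I : x₁ x₂^{d-1} xₙ^{d-2})` in the remaining cases. -/
theorem NormalForm.exists_v_eq (h : NormalForm d u v l) {one : Fin n} (hone : (one : ℕ) = 1)
    (hnot : ¬ ∃ m, IsColon (lexsegment d u v) m {i | 1 ≤ (i : ℕ)}) :
    ∃ i : Fin n, i ≠ 0 ∧ (i : ℕ) + 2 ≤ l ∧ v = Finsupp.single one (d - 1) + Finsupp.single i 1 := by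
  have hd := h.two_le
  have hval : ∀ i : Fin n, i ≠ 0 → 1 ≤ (i : ℕ) := fun i hi =>
    Nat.one_le_iff_ne_zero.mpr fun h1 => hi (Fin.val_eq_zero_iff.mp h1)
  have hone0 : one ≠ 0 := by rintro rfl; simp at hone
  obtain ⟨last, -, hle⟩ := exists_last n
  have hlast0 : last ≠ 0 := (h.l_pos.trans_le (hle l)).ne'
  by_cases hl1 : (l : ℕ) = 1
  · refine absurd ?_ hnot
    obtain ⟨m, hm⟩ := exists_add_of_le
      (Finsupp.single_le_iff.mpr (Nat.one_le_iff_ne_zero.mpr h.u_l))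
    have hdeg : m.degree + 1 = d := by
      rw [← h.degree_u, hm, map_add, Finsupp.degree_single, add_comm]
    have hm0 : m 0 = 1 := by
      have := h.u_zero
      rw [hm] at this
      simpa [h.l_pos.ne] using this
    refine ⟨m, h.isColon_tail hm0 (fun i hi => ?_) fun hmem => ?_⟩
    · refine h.mem_iff.mpr (Or.inr ⟨_, ⟨?_, ?_, ?_⟩, le_rfl⟩)
      · rw [map_add, Finsupp.degree_single, hdeg]
      · simp [hm0, hi]
      · have hli : l ≤ i := Fin.le_def.mpr (hl1 ▸ hval i hi)
        conv_rhs => rw [hm, add_comm]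
        exact add_le_add_right (Finsupp.Lex.single_le_iff.mpr hli) (toLex m)
    · have := degree_le_of_mem_upperClosure_lexsegment hmem
      omega
  have honel : one < l := Fin.lt_def.mpr (by have := hval l h.l_pos.ne'; omega)
  have htaildeg : ∀ {z : Fin n →₀ ℕ}, z ∈ tailSegment d v →
      (∀ i ≠ 0, z i ≤ Finsupp.single one (d - 1) i) → False := fun {z} hz hzm => by
    have : z ≤ Finsupp.single one (d - 1) := fun i => by
      rcases eq_or_ne i 0 with rfl | hi
      · simp [hz.2.1]
      · exact hzm i hi
    have := Finsupp.degree_mono this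
    rw [hz.1, Finsupp.degree_single] at this
    omega
  have hzone : ∀ {z}, z ∈ headSegment d u → z one = 0 := fun {z} hz =>
    apply_eq_zero_of_mem_head h.u_zero h.u_between hz (Fin.pos_iff_ne_zero.mpr hone0) honel
  by_cases hvle : toLex v ≤ toLex (Finsupp.single one (d - 1) + Finsupp.single last 1)
  · refine absurd ⟨Finsupp.single 0 1 + Finsupp.single one (d - 1), h.isColon_tail ?_
      (fun i hi => ?_) fun hmem => ?_⟩ hnot
    · simp [hone0]
    · refine h.mem_iff.mpr (Or.inl ⟨Finsupp.single one (d - 1) + Finsupp.single i 1,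
        ⟨?_, ?_, hvle.trans ?_⟩, ?_⟩)
      · rw [map_add, Finsupp.degree_single, Finsupp.degree_single]; omega
      · simp [hone0, hi]
      · exact add_le_add_right (Finsupp.Lex.single_le_iff.mpr (hle i)) _
      · rw [add_assoc]
        exact le_add_of_nonneg_left zero_le
    · rcases h.mem_iff.mp hmem with ⟨z, hz, hzm⟩ | ⟨z, hz, hzm⟩
      · exact htaildeg hz fun i hi => by simpa [hi.symm] using hzm i
      · have heq := eq_of_le_of_degree_eq hzm (by
          rw [hz.1, map_add, Finsupp.degree_single, Finsupp.degree_single]; omega)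
        have := hzone hz
        rw [heq] at this
        simp [hone0.symm] at this
        omega
  · rw [not_le] at hvle
    have hvone : d - 1 ≤ v one := by
      by_contra! hcon
      refine absurd hvle (lex_lt_of one (fun i hi => ?_) (hcon.trans_le (by simp))).not_gt
      have : i = 0 := by rw [Fin.lt_def] at hi; exact Fin.val_eq_zero_iff.mp (by omega)
      simp [this, h.v_zero, hone0, hlast0]
    obtain ⟨r, hr⟩ := exists_add_of_le (Finsupp.single_le_iff.mpr hvone)
    have hrdeg : r.degree = 1 := by
      have := h.degree_v
      rw [hr, map_add, Finsupp.degree_single] at this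
      omega
    obtain ⟨i, rfl⟩ : r ∈ Set.range fun a : Fin n => Finsupp.single a 1 := by
      rw [Finsupp.range_single_one]; exact hrdeg
    have hi0 : i ≠ 0 := by
      rintro rfl
      have := h.v_zero
      rw [hr] at this
      simp [hone0] at this
    refine ⟨i, hi0, ?_, hr⟩
    by_contra! hil
    have hilast : i < last := by
      refine lt_of_le_of_ne (hle i) ?_
      rintro rfl
      rw [hr] at hvle
      exact lt_irrefl _ hvle
    refine hnot ⟨Finsupp.single 0 1 + Finsupp.single one (d - 1) + Finsupp.single last (d - 2),
      h.isColon_tail ?_ (fun p hp => ?_) fun hmem => ?_⟩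
    · simp [hone0, hlast0]
    · rw [h.mem_iff]
      rcases le_or_gt p i with hpi | hpi
      · left
        refine ⟨Finsupp.single one (d - 1) + Finsupp.single p 1, ⟨?_, ?_, ?_⟩, ?_⟩
        · rw [map_add, Finsupp.degree_single, Finsupp.degree_single]; omega
        · simp [hone0, hp]
        · conv_lhs => rw [hr]
          exact add_le_add_right (Finsupp.Lex.single_le_iff.mpr hpi) (toLex _)
        · refine add_le_add_left ?_ _
          rw [add_right_comm]
          exact le_add_of_nonneg_left zero_le
      · right
        refine ⟨_, add_single_last_mem_head hd h.degree_u h.u_zero h.l_pos h.u_l hle (p := p)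
          (Fin.le_def.mpr (by rw [Fin.lt_def] at hpi; omega)), fun k => ?_⟩
        simp only [Finsupp.add_apply]
        omega
    · rcases h.mem_iff.mp hmem with ⟨z, hz, hzm⟩ | ⟨z, hz, hzm⟩
      · refine htaildeg hz fun k hk => ?_
        rcases eq_or_ne k last with rfl | hkl
        · rw [apply_eq_zero_of_mem_tail hd hone hr hilast hz]
          exact Nat.zero_le _
        · simpa [hk.symm, hkl.symm] using hzm k
      · have : z ≤ Finsupp.single 0 1 + Finsupp.single last (d - 2) := fun k => by
          rcases eq_or_ne k one with rfl | hk
          · rw [hzone hz]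
            exact Nat.zero_le _
          · simpa [hk.symm] using hzm k
        have := Finsupp.degree_mono this
        rw [hz.1, map_add, Finsupp.degree_single, Finsupp.degree_single] at this
        omega

/-- If `v = x₂^{d-1} x_i` with `i ≤ l - 2`, then `x_{l-1}, x₁ - xₙ` is a regular sequence:
`x_{l-1}` occurs in no generator of the ideal, and no associated prime of the ideal
enlarged by `x_{l-1}` contains both `x₁` and `xₙ`. -/
theorem NormalForm.two_le_depth (K : Type*) [Field K] (h : NormalForm d u v l) {one i : Fin n}
    (hone : (one : ℕ) = 1) (hil : (i : ℕ) + 2 ≤ l)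
    (hv : v = Finsupp.single one (d - 1) + Finsupp.single i 1) :
    2 ≤ depth K n (MvPolynomial (Fin n) K ⧸ lexsegmentIdeal K d u v) := by
  classical
  obtain ⟨last, -, hle⟩ := exists_last n
  have hll := Fin.le_def.mp (hle l)
  have hln := l.2
  let p : Fin n := ⟨l - 1, by omega⟩
  have hpl : p < l := Fin.lt_def.mpr (by simp only [p]; omega)
  have hip : i < p := Fin.lt_def.mpr (by simp only [p]; omega)
  have hp0 : 0 < p := (Fin.zero_le i).trans_lt hip
  have hilast : i < last := hip.trans (hpl.trans_le (hle l))
  have hlast0 : last ≠ 0 := ((Fin.zero_le i).trans_lt hilast).ne'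
  have hmax : ∀ i : Fin n, (X i : MvPolynomial (Fin n) K) ∈ maxIdeal K n := fun i =>
    Ideal.subset_span ⟨i, rfl⟩
  have hsup : lexsegmentIdeal K d u v ⊔ Ideal.span {X p} =
      Ideal.span ((fun w => monomial w (1 : K)) ''
        (lexsegment d u v ∪ {Finsupp.single p 1})) := by
    rw [Set.image_union, Set.image_singleton, Ideal.span_union]
    rfl
  refine two_le_depth_of_regular_pair (f := X p) (g := X 0 - X last) ?_ (hmax p)
    (Ideal.sub_mem _ (hmax 0) (hmax last)) (fun a ha => ?_) fun a ha => ?_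
  · rw [lexsegmentIdeal, Ideal.span_le]
    rintro _ ⟨w, ⟨hw, -⟩, rfl⟩
    rw [maxIdeal, ← Set.image_univ, SetLike.mem_coe, mem_ideal_span_X_image]
    intro x hx
    rw [support_monomial, if_neg one_ne_zero, Finset.mem_singleton] at hx
    subst hx
    by_contra! hcon
    have h0 : x = 0 := Finsupp.ext fun k => hcon k trivial
    have := h.two_le
    rw [h0, map_zero] at hw
    omega
  · rw [lexsegmentIdeal] at ha ⊢
    rw [mem_span_monomial_iff]
    intro x hx
    have h1 := monomial_mul_mem_span_monomial_iff.mp ha x hx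
    rw [add_comm, h.mem_iff] at h1
    rw [h.mem_iff]
    refine h1.imp ?_ (mem_head_of_add_single h.u_zero h.u_between hp0 hpl)
    rintro ⟨z, hz, hzx⟩
    refine ⟨z, hz, le_add_single_of_eq_zero hzx ?_⟩
    rw [apply_eq_zero_of_mem_tail h.two_le hone hv hip hz]
    exact Nat.zero_le _
  · rw [hsup] at ha ⊢
    by_contra hnot
    obtain ⟨F, m, hF, hmem⟩ := exists_isColon_of_mul_mem ha hnot
    rw [mem_ideal_span_X_image] at hmem
    have h0 : (0 : Fin n) ∈ F := by
      obtain ⟨k, hk, hk0⟩ := hmem (Finsupp.single 0 1) (by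
        simp [coeff_X, Finsupp.single_left_inj, hlast0])
      rw [Finsupp.single_apply_ne_zero] at hk0
      exact hk0.1 ▸ hk
    have hlastF : last ∈ F := by
      obtain ⟨k, hk, hk0⟩ := hmem (Finsupp.single last 1) (by
        simp [coeff_X, Finsupp.single_left_inj, hlast0.symm])
      rw [Finsupp.single_apply_ne_zero] at hk0
      exact hk0.1 ▸ hk
    have hup : ∀ {x : Fin n →₀ ℕ}, x ∈ upperClosure (lexsegment d u v ∪ {Finsupp.single p 1}) ↔
        x ∈ upperClosure (lexsegment d u v) ∨ 1 ≤ x p := fun {x} => by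
      simp only [mem_upperClosure, Set.mem_union, or_and_right, exists_or,
        Set.mem_singleton_iff, exists_eq_left, Finsupp.single_le_iff]
    have hm := hF.notMem
    rw [hup, not_or] at hm
    have hm0 := (hup.mp (hF.1 0 h0)).resolve_right (by simpa [hp0.ne] using hm.2)
    have hlp : last ≠ p := (hpl.trans_le (hle l)).ne'
    have hmlast := (hup.mp (hF.1 last hlastF)).resolve_right (by simpa [hlp] using hm.2)
    have hz := h.eq_zero_of_add_single_zero_mem hm.1 hm0
    rw [h.mem_iff] at hmlast
    obtain ⟨z, hz, hzm⟩ := hmlast.resolve_right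
      (notMem_head_of_apply_zero (by simp [hz, hlast0]))
    refine hm.1 (h.mem_iff.mpr (Or.inl ⟨z, hz, le_add_single_of_eq_zero hzm ?_⟩))
    rw [apply_eq_zero_of_mem_tail h.two_le hone hv hilast hz]
    exact Nat.zero_le _

/-! ### The set of associated primes -/

theorem apply_zero_eq_one (hu : u.degree = d) (hu0 : u 0 ≠ 0) (hv0 : v 0 = 0)
    (hnot : ∀ m, ¬ IsColon (lexsegment d u v) m Set.univ) : u 0 = 1 := by
  obtain ⟨m, hm⟩ := exists_add_of_le
    (Finsupp.single_le_iff.mpr (Nat.one_le_iff_ne_zero.mpr hu0))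
  have hdeg : m.degree + 1 = d := by
    rw [← hu, hm, map_add, Finsupp.degree_single, add_comm]
  have hu0' : u 0 = 1 + m 0 := by rw [hm]; simp
  by_contra hne
  -- If `x₁² ∣ u`, then `u / x₁` is annihilated by all variables.
  refine hnot m ⟨fun i _ => ⟨_, ⟨?_, ?_, ?_⟩, le_rfl⟩, fun y hy hmem => ?_⟩
  · rw [map_add, Finsupp.degree_single, hdeg]
  · conv_rhs => rw [hm, add_comm]
    exact add_le_add_right (Finsupp.Lex.single_le_iff.mpr (Fin.zero_le i)) (toLex m)
  · refine (lex_lt_of 0 (fun i hi => absurd hi (by simp)) ?_).le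
    rw [hv0, Finsupp.add_apply]
    omega
  · have hy0 : y = 0 := Finsupp.ext fun i => hy i trivial
    have := degree_le_of_mem_upperClosure_lexsegment hmem
    rw [hy0, add_zero] at this
    omega

theorem exists_normalForm (hd : 2 ≤ d) (hu : u.degree = d) (hv : v.degree = d) (hu0 : u 0 = 1)
    (hv0 : v 0 = 0) : ∃ l, NormalForm d u v l := by
  have hne : {i : Fin n | i ≠ 0 ∧ u i ≠ 0}.Nonempty := by
    by_contra! hcon
    have hle : u ≤ Finsupp.single 0 1 := fun i => by
      rcases eq_or_ne i 0 with rfl | hi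
      · simp [hu0]
      · have : ¬ (i ≠ 0 ∧ u i ≠ 0) := fun h => Set.eq_empty_iff_forall_notMem.mp hcon i h
        have : u i = 0 := by tauto
        simp [this]
    have := Finsupp.degree_mono hle
    rw [hu, Finsupp.degree_single] at this
    omega
  obtain ⟨l, ⟨hl0, hl⟩, hmin⟩ := exists_least hne
  exact ⟨l, hd, hu, hv, hu0, hv0, Fin.pos_iff_ne_zero.mpr hl0, hl, fun i hi hil =>
    by_contra fun h => hmin i hil ⟨hi.ne', h⟩⟩

/-- The associated primes without reference to the depth. Whether `(x₂, …, xₙ)` is among them is left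
open here; the depth decides it. -/
theorem NormalForm.mem_associatedPrimes_iff {K : Type*} [Field K] (h : NormalForm d u v l)
    (hnot : ∀ m, ¬ IsColon (lexsegment d u v) m Set.univ) {P : Ideal (MvPolynomial (Fin n) K)} :
    P ∈ associatedPrimes (MvPolynomial (Fin n) K)
        (MvPolynomial (Fin n) K ⧸ lexsegmentIdeal K d u v) ↔
      (P = tailPrime K n ∧ tailPrime K n ∈ associatedPrimes (MvPolynomial (Fin n) K)
        (MvPolynomial (Fin n) K ⧸ lexsegmentIdeal K d u v)) ∨
      (∃ j ∈ v.support, (j : ℕ) ≠ n - 1 ∧ P = initialPrime K j) ∨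
      (∃ j ∈ v.support, (j : ℕ) + 2 ≤ l ∧ P = mixedPrime K n j l) ∨
      (u l < d - 1 ∧ ∃ j ∈ v.support, (j : ℕ) + 1 ≤ l ∧ P = mixedPrime K n j (l + 1)) := by
  simp only [Finsupp.mem_support_iff]
  constructor
  · intro hP
    obtain ⟨F, m, rfl, hF⟩ := mem_associatedPrimes_span_monomial_iff.mp hP
    by_cases h0 : 0 ∈ F
    · obtain ⟨j, hj, hjn, rfl⟩ := h.isColon_zero_mem hF h0 (by rintro rfl; exact hnot m hF)
      exact Or.inr (Or.inl ⟨j, hj, hjn, rfl⟩)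
    · rcases h.isColon_zero_notMem hF h0 with rfl | ⟨j, hj, hjl, rfl⟩ | ⟨j, hj, hjl, hul, rfl⟩
      · exact Or.inl ⟨rfl, hP⟩
      · exact Or.inr (Or.inr (Or.inl ⟨j, hj, hjl, rfl⟩))
      · refine Or.inr (Or.inr (Or.inr ⟨lt_of_le_of_ne ?_ hul, j, hj, hjl, rfl⟩))
        have hle : Finsupp.single 0 1 + Finsupp.single l (u l) ≤ u := fun i => by
          rcases eq_or_ne i 0 with rfl | hi0
          · simp [h.l_pos.ne, h.u_zero]
          rcases eq_or_ne i l with rfl | hil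
          · simp [hi0.symm]
          · simp [hi0.symm, hil.symm]
        have := Finsupp.degree_mono hle
        rw [map_add, Finsupp.degree_single, Finsupp.degree_single, h.degree_u] at this
        omega
  · rintro (⟨rfl, hP⟩ | ⟨j, hj, hjn, rfl⟩ | ⟨j, hj, hjl, rfl⟩ | ⟨hul, j, hj, hjl, rfl⟩)
    · exact hP
    · obtain ⟨m, hm⟩ := h.exists_isColon_initial hj hjn
      exact mem_associatedPrimes_span_monomial_iff.mpr ⟨_, m, rfl, hm⟩
    · obtain ⟨m, hm⟩ := h.exists_isColon_mixed_l hj hjl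
      exact mem_associatedPrimes_span_monomial_iff.mpr ⟨_, m, rfl, hm⟩
    · obtain ⟨m, hm⟩ := h.exists_isColon_mixed_l_succ hul hj hjl
      exact mem_associatedPrimes_span_monomial_iff.mpr ⟨_, m, rfl, hm⟩

theorem NormalForm.exists_v_eq_of_tailPrime_notMem {K : Type*} [Field K] (h : NormalForm d u v l)
    {one : Fin n} (hone : (one : ℕ) = 1)
    (hnot : tailPrime K n ∉ associatedPrimes (MvPolynomial (Fin n) K)
        (MvPolynomial (Fin n) K ⧸ lexsegmentIdeal K d u v)) :
    ∃ i : Fin n, i ≠ 0 ∧ (i : ℕ) + 2 ≤ l ∧ v = Finsupp.single one (d - 1) + Finsupp.single i 1 :=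
  h.exists_v_eq hone fun ⟨m, hm⟩ =>
    hnot (mem_associatedPrimes_span_monomial_iff.mpr ⟨_, m, rfl, hm⟩)

end TailPrime

end LexSegment

theorem proposition2p5 {K : Type*} [Field K] {n : ℕ} [NeZero n] (d : ℕ) (hd : 2 ≤ d)
    (u v : Fin n →₀ ℕ) (hu : u.degree = d) (hv : v.degree = d)
    (hu1 : u 0 ≠ 0) (hv1 : v 0 = 0)
    (hdepth : 0 < LexSegment.depth K n
      (MvPolynomial (Fin n) K ⧸ LexSegment.lexsegmentIdeal K d u v)) :
    -- `u = x₁ x_l^{a_l} ⋯ xₙ^{aₙ}` with `a_l = u l > 0`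
    u 0 = 1 ∧ ∃ l : Fin n, 0 < l ∧ 0 < u l ∧ (∀ i : Fin n, 0 < i → i < l → u i = 0) ∧
    -- the case of depth one
    (LexSegment.depth K n (MvPolynomial (Fin n) K ⧸ LexSegment.lexsegmentIdeal K d u v) = 1 →
      (u l < d - 1 →
        associatedPrimes (MvPolynomial (Fin n) K)
            (MvPolynomial (Fin n) K ⧸ LexSegment.lexsegmentIdeal K d u v) =
          {LexSegment.tailPrime K n}
          ∪ {P | ∃ j ∈ v.support, (j : ℕ) ≠ n - 1 ∧ P = LexSegment.initialPrime K j}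
          ∪ {P | ∃ j ∈ v.support, (j : ℕ) + 2 ≤ l ∧ P = LexSegment.mixedPrime K n j l}
          ∪ {P | ∃ j ∈ v.support, (j : ℕ) + 1 ≤ l ∧ P = LexSegment.mixedPrime K n j (l + 1)}) ∧
      (u l = d - 1 →
        associatedPrimes (MvPolynomial (Fin n) K)
            (MvPolynomial (Fin n) K ⧸ LexSegment.lexsegmentIdeal K d u v) =
          {LexSegment.tailPrime K n}
          ∪ {P | ∃ j ∈ v.support, (j : ℕ) ≠ n - 1 ∧ P = LexSegment.initialPrime K j}
          ∪ {P | ∃ j ∈ v.support, (j : ℕ) + 2 ≤ l ∧ P = LexSegment.mixedPrime K n j l})) ∧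
    -- the case of depth greater than one
    (1 < LexSegment.depth K n (MvPolynomial (Fin n) K ⧸ LexSegment.lexsegmentIdeal K d u v) →
      (∀ j ∈ v.support, (j : ℕ) + 2 ≤ l) ∧
      (u l < d - 1 →
        associatedPrimes (MvPolynomial (Fin n) K)
            (MvPolynomial (Fin n) K ⧸ LexSegment.lexsegmentIdeal K d u v) =
          {P | ∃ j ∈ v.support, (j : ℕ) ≠ n - 1 ∧ P = LexSegment.initialPrime K j}
          ∪ {P | ∃ j ∈ v.support, P = LexSegment.mixedPrime K n j l}
          ∪ {P | ∃ j ∈ v.support, P = LexSegment.mixedPrime K n j (l + 1)}) ∧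
      (u l = d - 1 →
        associatedPrimes (MvPolynomial (Fin n) K)
            (MvPolynomial (Fin n) K ⧸ LexSegment.lexsegmentIdeal K d u v) =
          {P | ∃ j ∈ v.support, (j : ℕ) ≠ n - 1 ∧ P = LexSegment.initialPrime K j}
          ∪ {P | ∃ j ∈ v.support, P = LexSegment.mixedPrime K n j l})) := by
  have hmax := LexSegment.maxIdeal_notMem_associatedPrimes hdepth
  have hnot : ∀ m, ¬ LexSegment.IsColon (LexSegment.lexsegment d u v) m Set.univ := fun m hm =>
    hmax (LexSegment.mem_associatedPrimes_span_monomial_iff.mpr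
      ⟨_, m, by rw [LexSegment.maxIdeal, Set.image_univ], hm⟩)
  have hu0 := LexSegment.apply_zero_eq_one hu hu1 hv1 hnot
  obtain ⟨l, h⟩ := LexSegment.exists_normalForm hd hu hv hu0 hv1
  have hn : 1 < n := lt_of_le_of_lt (Fin.lt_def.mp h.l_pos) l.2
  refine ⟨hu0, l, h.l_pos, Nat.pos_of_ne_zero h.u_l, h.u_between, fun hdep => ?_, fun hdep => ?_⟩
  · have htail : LexSegment.tailPrime K n ∈ associatedPrimes (MvPolynomial (Fin n) K)
        (MvPolynomial (Fin n) K ⧸ LexSegment.lexsegmentIdeal K d u v) := by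
      by_contra hcon
      obtain ⟨i, hi, hil, hvi⟩ := h.exists_v_eq_of_tailPrime_notMem (one := ⟨1, hn⟩) rfl hcon
      have := h.two_le_depth K rfl hil hvi
      rw [hdep] at this
      exact absurd this (by norm_num)
    refine ⟨fun hul => ?_, fun hul => ?_⟩
    · ext P
      rw [h.mem_associatedPrimes_iff hnot]
      simp only [htail, and_true, hul, true_and, Set.mem_union, Set.mem_singleton_iff,
        Set.mem_ofPred_eq, or_assoc]
    · ext P
      rw [h.mem_associatedPrimes_iff hnot]
      simp only [htail, and_true, hul, lt_irrefl, false_and, or_false, Set.mem_union,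
        Set.mem_singleton_iff, Set.mem_ofPred_eq, or_assoc]
  · have htail := LexSegment.tailPrime_notMem_associatedPrimes hdep
    have hsupp : ∀ j ∈ v.support, (j : ℕ) + 2 ≤ l := by
      obtain ⟨i, hi, hil, hvi⟩ := h.exists_v_eq_of_tailPrime_notMem (one := ⟨1, hn⟩) rfl htail
      have hi1 : 1 ≤ (i : ℕ) := Nat.one_le_iff_ne_zero.mpr fun h0 => hi (Fin.val_eq_zero_iff.mp h0)
      intro j hj
      by_contra! hcon
      rw [Finsupp.mem_support_iff, hvi] at hj
      refine hj ?_
      have h1 : j ≠ ⟨1, hn⟩ := by rintro rfl; simp at hcon; omega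
      have h2 : j ≠ i := by rintro rfl; omega
      simp [h1.symm, h2.symm]
    have h2 : ∀ Q : Fin n → Prop, (∃ j ∈ v.support, (j : ℕ) + 2 ≤ l ∧ Q j) ↔ ∃ j ∈ v.support, Q j :=
      fun Q => exists_congr fun j => and_congr_right fun hj => and_iff_right (hsupp j hj)
    have h1 : ∀ Q : Fin n → Prop, (∃ j ∈ v.support, (j : ℕ) + 1 ≤ l ∧ Q j) ↔ ∃ j ∈ v.support, Q j :=
      fun Q => exists_congr fun j => and_congr_right fun hj =>
        and_iff_right ((Nat.le_succ _).trans (hsupp j hj))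
    refine ⟨hsupp, fun hul => ?_, fun hul => ?_⟩
    · ext P
      rw [h.mem_associatedPrimes_iff hnot]
      simp only [htail, and_false, false_or, hul, true_and, Set.mem_union, Set.mem_ofPred_eq,
        or_assoc, h1, h2]
    · ext P
      rw [h.mem_associatedPrimes_iff hnot]
      simp only [htail, and_false, false_or, hul, lt_irrefl, false_and, or_false, Set.mem_union,
        Set.mem_ofPred_eq, h2]
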